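/- **Setting.** Let $\lambda,\xi>0$ and let $v_1,v_2$ satisfy $v_2<0<v_1$ or $0<v_2<v_1$. A geometric counting process (GCP) of intensity $\lambda$ is a mixed Poisson process whose random intensity is exponentially distributed with mean $\lambda$. Fix $j\in\{1,2\}$. A particle starts at time $0$ from the origin with velocity $v_j$ and alternates between the velocities $v_1,v_2$; the successive durations of the motion with velocity $v_1$, respectively $v_2$, are the intertimes of two independent GCPs of intensity $\lambda$. At the epochs of an independent Poisson process of rate $\xi$ the particle is instantaneously reset to the origin and restarts afresh (with independent new GCPs) with velocity $v_j$. Let $\tilde X(t)$ and $V(t)$ be its position and velocity at time $t$. Let $\tilde p_i(\cdot,t\,|\,v_j)$ be the generalized density of $B\mapsto P[\tilde X(t)\in B,\ V(t)=v_i]$, $i=1,2$, let $\tilde p=\tilde p_1+\tilde p_2$ be the generalized density of $\tilde X(t)$, and let $\tilde w=\tilde p_1-\tilde p_2$ be the flow function. (A finite signed Borel measure $\mu$ on $\mathbb R$ has generalized density $c\,\delta(x-a)+f(x)$ if $f$ is integrable and $\mu(B)=c\,\mathbf 1_B(a)+\int_B f(x)\,dx$ for all Borel $B$.) Write $\Gamma(a,z_0,z_1)=\int_{z_0}^{z_1}u^{a-1}e^{-u}\,du$,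 $M_x=\max\{x/v_1,x/v_2\}$, $m_{x,t}=\min\{x/v_2,t\}$, $\tau=\dfrac{x-v_2t}{v_1-v_2}$, $\boldsymbol I(x,t)=\mathbf 1_{\{\min\{v_2t,0\}<x<v_1t\}}$, $$\Gamma_\lambda^\xi(x,t)=\begin{cases}\Gamma\big[0,(M_x+\tfrac1\lambda)\xi,(t+\tfrac1\lambda)\xi\big], & v_2<0<v_1,\\ \Gamma\big[0,(\tfrac x{v_1}+\tfrac1\lambda)\xi,(m_{x,t}+\tfrac1\lambda)\xi\big], & 0<v_2<v_1,\end{cases}$$ $$\Theta_\lambda^\xi(x,t)=\begin{cases}\dfrac{e^{-\xi M_x}}{1+\lambda M_x}-\dfrac{e^{-\xi t}}{1+\lambda t}, & v_2<0<v_1,\\[2ex] \dfrac{e^{-\xi x/v_1}}{1+\lambda x/v_1}-\dfrac{e^{-\xi m_{x,t}}}{1+\lambda m_{x,t}}, & 0<v_2<v_1.\end{cases}$$ **Theorem.** For every $t>0$ and $j=1,2$, as generalized densities in $x\in\mathbb R$, $$\tilde p(x,t\,|\,v_j)=\frac{e^{-\xi t}\delta(x-v_jt)}{1+\lambda t}+\operatorname{sgn}(v_j)\mathbf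 1_{\{0<\frac x{v_j}<t\}}\frac{\xi e^{-\xi x/v_j}}{v_j+\lambda x}+\mathbf 1_{\{v_2t<x<v_1t\}}\frac{e^{-\xi t}\lambda}{(v_1-v_2)(1+\lambda t)}+\boldsymbol I(x,t)\frac{\xi e^{\xi/\lambda}}{v_1-v_2}\Gamma_\lambda^\xi(x,t)$$ and $$\begin{aligned}\tilde w(x,t\,|\,v_j)={}&(-1)^{j-1}\frac{e^{-\xi t}\delta(x-v_jt)}{1+\lambda t}+\mathbf 1_{\{v_2t<x<v_1t\}}\frac{\lambda e^{-\xi t}\big[\lambda(2\tau-t)+(-1)^j\big]}{(v_1-v_2)(1+\lambda t)^2}\\&+\operatorname{sgn}(v_j)(-1)^{j-1}\mathbf 1_{\{0<\frac x{v_j}<t\}}\frac{\xi e^{-\xi x/v_j}}{v_j+\lambda x}+\boldsymbol I(x,t)\Big\{\frac{2\xi(v_{3-j}+\lambda x)}{(v_1-v_2)^2}\Theta_\lambda^\xi(x,t)\\&-\frac{\xi e^{\xi/\lambda}}{(v_1-v_2)^2}\Big[2v_{3-j}\,\xi\Big(\frac x{v_{3-j}}+\frac1\lambda\Big)+(v_1+v_2)\Big]\Gamma_\lambda^\xi(x,t)\Big\}.\end{aligned}$$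 -/

import Mathlib

open MeasureTheory ProbabilityTheory

noncomputable section

/-! ### Geometric counting process and the random input -/

/-- The joint law of the intertimes of a geometric counting process (GCP) with intensity `lam`,
that is of the mixed Poisson process `t ↦ N (A * t)`, where `N` is a Poisson process of rate `1`
(intertimes i.i.d. exponential of mean `1`) and the random intensity `A` is independent of `N` and
exponentially distributed with mean `lam`.  Given `A = a` the intertimes are i.i.d. exponential of
rate `a`.  (`expMeasure r` is the exponential law of rate `r`, i.e. of mean `r⁻¹`.) -/
def gcpIntertimeLaw (lam : ℝ) : Measure (ℕ → ℝ) :=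
  ((expMeasure lam⁻¹).prod (Measure.infinitePi fun _ : ℕ => expMeasure 1)).map
    fun p n => p.2 n / p.1

/-- The random input of the telegraph process with resets.
* `R m`, `m = 0, 1, …`, are the intertimes of the Poisson process of resets, of rate `xi`.
* `D m i n` is the length of the `n`-th (from `n = 0`) interval during which the particle moves with
  velocity number `i`, in the motion that follows the `m`-th reset (`m = 0` being the motion that
  starts at time `0`).  For every `m` and `i` these are the intertimes of a GCP of intensity `lam`.

The GCPs for the two velocities are independent, the motion restarts afresh at each reset, and the
reset times are independent of the GCPs. -/
structure IsResetTelegraphInput {Ω : Type*} [MeasurableSpace Ω] (P : Measure Ω) (lam xi : ℝ)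
    (R : ℕ → Ω → ℝ) (D : ℕ → Fin 2 → ℕ → Ω → ℝ) : Prop where
  reset_law : ∀ m, HasLaw (R m) (expMeasure xi) P
  reset_indep : iIndepFun R P
  sojourn_law : ∀ m i, HasLaw (fun ω n => D m i n ω) (gcpIntertimeLaw lam) P
  sojourn_indep : iIndepFun (fun (q : ℕ × Fin 2) ω n => D q.1 q.2 n ω) P
  reset_indep_sojourn :
    IndepFun (fun ω m => R m ω) (fun ω (q : ℕ × Fin 2) n => D q.1 q.2 n ω) P

/-! ### The paths

The index `0 : Fin 2` stands for the first velocity `v₁`, the index `1 : Fin 2` for the second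
velocity `v₂`; if `j` is one of the indices then `1 - j` is the other one. -/

/-- The `n`-th epoch of the counting process with intertimes `d 0, d 1, …`. -/
def epoch (d : ℕ → ℝ) (n : ℕ) : ℝ := ∑ k ∈ Finset.range n, d k

/-- The number of epochs `n ≥ 1` up to time `t` of the counting process with intertimes `d`. -/
def countUpTo (d : ℕ → ℝ) (t : ℝ) : ℕ := {n : ℕ | 1 ≤ n ∧ epoch d n ≤ t}.ncard

/-- The intertimes of the alternating counting process of velocity changes when the motion starts
with velocity number `j`: `d j 0, d (1 - j) 0, d j 1, d (1 - j) 1, …`. -/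
def alternating (j : Fin 2) (d : Fin 2 → ℕ → ℝ) (n : ℕ) : ℝ :=
  if Even n then d j (n / 2) else d (1 - j) (n / 2)

/-- Velocity at time `t` of the telegraph process without resets, with initial velocity `v j`. -/
def telegraphVelocity (v : Fin 2 → ℝ) (j : Fin 2) (d : Fin 2 → ℕ → ℝ) (t : ℝ) : ℝ :=
  (v 0 + v 1) / 2
    + (-1) ^ (j : ℕ) * ((v 0 - v 1) / 2) * (-1) ^ countUpTo (alternating j d) t

/-- Position at time `t` of the telegraph process without resets, started from the origin. -/
def telegraphPosition (v : Fin 2 → ℝ) (j : Fin 2) (d : Fin 2 → ℕ → ℝ) (t : ℝ) : ℝ :=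
  ∫ s in (0 : ℝ)..t, telegraphVelocity v j d s

/-- Time elapsed at time `t` since the last reset (since time `0` if there was none), when the
intertimes of the resets are `r`. -/
def ageOfReset (r : ℕ → ℝ) (t : ℝ) : ℝ := t - epoch r (countUpTo r t)

/-- Velocity at time `t` of the telegraph process with resets: at each reset the particle restarts
with its initial velocity `v j`. -/
def resetVelocity {Ω : Type*} (v : Fin 2 → ℝ) (R : ℕ → Ω → ℝ) (D : ℕ → Fin 2 → ℕ → Ω → ℝ)
    (j : Fin 2) (t : ℝ) (ω : Ω) : ℝ :=
  telegraphVelocity v j (fun i n => D (countUpTo (fun m => R m ω) t) i n ω)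
    (ageOfReset (fun m => R m ω) t)

/-- Position at time `t` of the telegraph process with resets: at each reset the particle is put
back to the origin. -/
def resetPosition {Ω : Type*} (v : Fin 2 → ℝ) (R : ℕ → Ω → ℝ) (D : ℕ → Fin 2 → ℕ → Ω → ℝ)
    (j : Fin 2) (t : ℝ) (ω : Ω) : ℝ :=
  telegraphPosition v j (fun i n => D (countUpTo (fun m => R m ω) t) i n ω)
    (ageOfReset (fun m => R m ω) t)

/-! ### Generalized densities -/

/-- The (signed) set function `μ` on the Borel sets of the line has the generalized density
`x ↦ c * δ(x - a) + f x`, with `f` integrable. -/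
def HasGeneralizedDensity (μ : Set ℝ → ℝ) (c a : ℝ) (f : ℝ → ℝ) : Prop :=
  Integrable f volume ∧
    ∀ B : Set ℝ, MeasurableSet B → μ B = c * B.indicator (fun _ => (1 : ℝ)) a + ∫ x in B, f x

/-- `P[X̃(t) ∈ B | X̃(0) = 0, V(0) = v_j]`, whose generalized density is `p̃(·, t | v_j)`. -/
def positionLaw {Ω : Type*} [MeasurableSpace Ω] (P : Measure Ω) (v : Fin 2 → ℝ)
    (R : ℕ → Ω → ℝ) (D : ℕ → Fin 2 → ℕ → Ω → ℝ) (j : Fin 2) (t : ℝ) (B : Set ℝ) : ℝ :=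
  P.real {ω | resetPosition v R D j t ω ∈ B}

/-- `P[X̃(t) ∈ B, V(t) = v_i | X̃(0) = 0, V(0) = v_j]`, whose generalized density is
`p̃_i(·, t | v_j)`. -/
def positionSubLaw {Ω : Type*} [MeasurableSpace Ω] (P : Measure Ω) (v : Fin 2 → ℝ)
    (R : ℕ → Ω → ℝ) (D : ℕ → Fin 2 → ℕ → Ω → ℝ) (j i : Fin 2) (t : ℝ) (B : Set ℝ) : ℝ :=
  P.real {ω | resetPosition v R D j t ω ∈ B ∧ resetVelocity v R D j t ω = v i}

/-- The signed measure whose generalized density is the flow function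
`w̃(·, t | v_j) = p̃_1(·, t | v_j) - p̃_2(·, t | v_j)`. -/
def flowMeasure {Ω : Type*} [MeasurableSpace Ω] (P : Measure Ω) (v : Fin 2 → ℝ)
    (R : ℕ → Ω → ℝ) (D : ℕ → Fin 2 → ℕ → Ω → ℝ) (j : Fin 2) (t : ℝ) (B : Set ℝ) : ℝ :=
  positionSubLaw P v R D j 0 t B - positionSubLaw P v R D j 1 t B

/-! ### The functions in the closed forms -/

/-- Indicator of a proposition. -/
def ind (A : Prop) : ℝ := open Classical in if A then 1 else 0

/-- Generalized incomplete Gamma function `Γ(a, z₀, z₁) = ∫_{z₀}^{z₁} u ^ (a - 1) * e ^ (-u) du`. -/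
def genIncGamma (a z₀ z₁ : ℝ) : ℝ := ∫ u in z₀..z₁, u ^ (a - 1) * Real.exp (-u)

/-- `τ(x, t) = (x - v₂ t) / (v₁ - v₂)`. -/
def tau (v : Fin 2 → ℝ) (x t : ℝ) : ℝ := (x - v 1 * t) / (v 0 - v 1)

/-- `M_x = max {x / v₁, x / v₂}`. -/
def bigM (v : Fin 2 → ℝ) (x : ℝ) : ℝ := max (x / v 0) (x / v 1)

/-- `m_{x,t} = min {x / v₂, t}`. -/
def smallM (v : Fin 2 → ℝ) (x t : ℝ) : ℝ := min (x / v 1) t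

/-- The function `Γ_λ^ξ(x, t)`; the two branches are `v₂ < 0 < v₁` and `0 < v₂ < v₁`. -/
def GammaFun (v : Fin 2 → ℝ) (lam xi x t : ℝ) : ℝ :=
  if v 1 < 0 then genIncGamma 0 ((bigM v x + 1 / lam) * xi) ((t + 1 / lam) * xi)
  else genIncGamma 0 ((x / v 0 + 1 / lam) * xi) ((smallM v x t + 1 / lam) * xi)

/-- The function `Θ_λ^ξ(x, t)`; the two branches are `v₂ < 0 < v₁` and `0 < v₂ < v₁`. -/
def ThetaFun (v : Fin 2 → ℝ) (lam xi x t : ℝ) : ℝ :=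
  if v 1 < 0 then
    Real.exp (-xi * bigM v x) / (1 + lam * bigM v x) - Real.exp (-xi * t) / (1 + lam * t)
  else
    Real.exp (-xi * (x / v 0)) / (1 + lam * (x / v 0))
      - Real.exp (-xi * smallM v x t) / (1 + lam * smallM v x t)

/-- `I(x, t)`, the indicator of `min {v₂ t, 0} < x < v₁ t`. -/
def boldI (v : Fin 2 → ℝ) (x t : ℝ) : ℝ := ind (min (v 1 * t) 0 < x ∧ x < v 0 * t)

/-- The regular part of the generalized density `p̃(x, t | v_j)`. -/
def densityRegular (v : Fin 2 → ℝ) (lam xi : ℝ) (j : Fin 2) (t x : ℝ) : ℝ :=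
  Real.sign (v j) * ind (0 < x / v j ∧ x / v j < t)
      * (xi * Real.exp (-xi * (x / v j)) / (v j + lam * x))
    + ind (v 1 * t < x ∧ x < v 0 * t)
      * (Real.exp (-xi * t) * lam / ((v 0 - v 1) * (1 + lam * t)))
    + boldI v x t * (xi * Real.exp (xi / lam) / (v 0 - v 1)) * GammaFun v lam xi x t

/-- The regular part of the flow function `w̃(x, t | v_j)`.  As `j : Fin 2` counts from `0`,
`(-1) ^ j` is `1` for the initial velocity `v₁` and `-1` for the initial velocity `v₂`. -/
def flowRegular (v : Fin 2 → ℝ) (lam xi : ℝ) (j : Fin 2) (t x : ℝ) : ℝ :=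
  ind (v 1 * t < x ∧ x < v 0 * t)
      * (lam * Real.exp (-xi * t) * (lam * (2 * tau v x t - t) - (-1) ^ (j : ℕ))
        / ((v 0 - v 1) * (1 + lam * t) ^ 2))
    + Real.sign (v j) * (-1) ^ (j : ℕ) * ind (0 < x / v j ∧ x / v j < t)
      * (xi * Real.exp (-xi * (x / v j)) / (v j + lam * x))
    + boldI v x t *
      (2 * xi * (v (1 - j) + lam * x) / (v 0 - v 1) ^ 2 * ThetaFun v lam xi x t
        - xi * Real.exp (xi / lam) / (v 0 - v 1) ^ 2
          * (2 * v (1 - j) * xi * (x / v (1 - j) + 1 / lam) + (v 0 + v 1))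
          * GammaFun v lam xi x t)

end

/-! ### Laws with a density on the positive half-line -/

/-! At time `t` only the motion since the last reset matters. The age of that motion is `t` with
probability `e^(-ξt)` and otherwise has density `ξ e^(-ξa)` on `(0, t)`: the Erlang densities of the
reset epochs add up to the constant `ξ`, and no further reset occurs during an age `a` with
probability `e^(-ξa)` (`tsum_lintegral_ageValue`). Resets and sojourns are independent, so each law
of the reset process is `e^(-ξt) Q(t) + ∫₀ᵗ ξ e^(-ξa) Q(a) da`, where `Q(a)` is the corresponding
law of the free telegraph process at time `a` (`measure_resetUnion`).

For the free process, fix the number of turns. After `2k` turns exactly `k` sojourns with the other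
velocity are complete, so the time spent with it is the `k`-th epoch of its GCP, and the GCP of the
initial velocity counts exactly `k` epochs in the remaining time. After `2k + 1` turns the roles are
exchanged. Mixing Erlang laws over the exponential intensity gives rational epoch densities
(`map_div_prod_erlang`) and geometric counts (`gcp_count`). Their products form, up to a factor, the
series `∑ (k + 1) q^k`, which has a closed sum (`hasSum_gcp_odd`, `hasSum_gcp_even`); the term
without turns is the atom. The total mass found in this way is one, so these events exhaust the
probability space, and non-explosion needs no argument of its own (`ae_mem_resetUnion`).

The position is affine in the time spent with a velocity, hence densities in that time become
densities in `x` (`setLIntegral_mixture`). By Tonelli the age is then integrated at fixed `x`, over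
the ages at which `x` is within reach (`reachable_age_iff`, `lintegral_mixedDensity`).

The sum of the two free densities is `λ / ((v₁ - v₂)(1 + λa))`, constant in `x`. Their difference is
a combination of `λ/(1 + λa)` and `λ/(1 + λa)²` with coefficients that do not depend on `a`
(`same_sub_other'`). Against `ξ e^(-ξa)` the first integrates to the incomplete Gamma function
(`integral_exp_div`), and the second reduces to the first by parts, with boundary term `Θ`
(`integral_exp_div_sq`). -/

/-- The measure on `(0, ∞)` with density `f`. -/
noncomputable def halfLineMeasure (f : ℝ → ℝ) : Measure ℝ :=
  (volume.restrict (Set.Ioi 0)).withDensity fun x => ENNReal.ofReal (f x)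

/-- The density is finite everywhere, so the test function may be non-measurable. -/
theorem lintegral_halfLineMeasure {f : ℝ → ℝ} (hf : Measurable f) (F : ℝ → ENNReal) :
    ∫⁻ x, F x ∂(halfLineMeasure f) = ∫⁻ x in Set.Ioi 0, ENNReal.ofReal (f x) * F x := by
  rw [halfLineMeasure, lintegral_withDensity_eq_lintegral_mul_non_measurable _ (by fun_prop)]
  · rfl
  · exact Filter.Eventually.of_forall fun x => ENNReal.ofReal_lt_top

theorem expMeasure_eq_halfLineMeasure (r : ℝ) :
    expMeasure r = halfLineMeasure fun x => r * Real.exp (-(r * x)) := by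
  have h : expMeasure r = volume.withDensity (exponentialPDF r) := rfl
  rw [h, halfLineMeasure, ← withDensity_indicator measurableSet_Ioi]
  refine withDensity_congr_ae ?_
  -- The two densities disagree only at `0`, where `exponentialPDF` is positive.
  have h0 : ∀ᵐ x : ℝ, x ≠ 0 := by simp [ae_iff]
  filter_upwards [h0] with x hx
  rw [exponentialPDF_eq]
  by_cases h : 0 < x
  · simp [h, h.le]
  · have : ¬ 0 ≤ x := fun h' => h (lt_of_le_of_ne h' (Ne.symm hx))
    simp [h, this]

theorem lintegral_ofReal_Ioo {f : ℝ → ℝ} {a b : ℝ} (hab : a ≤ b)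
    (hf : ContinuousOn f (Set.Icc a b)) (h0 : ∀ x ∈ Set.Ioo a b, 0 ≤ f x) :
    ∫⁻ x in Set.Ioo a b, ENNReal.ofReal (f x) = ENNReal.ofReal (∫ x in a..b, f x) := by
  rw [intervalIntegral.integral_of_le hab, integral_Ioc_eq_integral_Ioo,
    ofReal_integral_eq_lintegral_ofReal]
  · exact (hf.integrableOn_Icc).mono_set Set.Ioo_subset_Icc_self
  · exact (ae_restrict_iff' measurableSet_Ioo).2 (Filter.Eventually.of_forall h0)

/-- The density on the half-line of the sum of `k + 1` independent exponential variables. -/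
noncomputable def erlangPDF (r : ℝ) (k : ℕ) (x : ℝ) : ℝ :=
  r ^ (k + 1) * x ^ k / k.factorial * Real.exp (-(r * x))

theorem continuous_erlangPDF (r : ℝ) (k : ℕ) : Continuous (erlangPDF r k) := by
  unfold erlangPDF; fun_prop

@[fun_prop]
theorem measurable_erlangPDF (r : ℝ) (k : ℕ) : Measurable (erlangPDF r k) :=
  (continuous_erlangPDF r k).measurable

theorem erlangPDF_nonneg {r x : ℝ} (hr : 0 < r) (hx : 0 ≤ x) (k : ℕ) : 0 ≤ erlangPDF r k x := by
  unfold erlangPDF; positivity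

theorem expMeasure_eq_erlang (r : ℝ) : expMeasure r = halfLineMeasure (erlangPDF r 0) := by
  rw [expMeasure_eq_halfLineMeasure]; congr 1; ext x; simp [erlangPDF]

theorem isProbabilityMeasure_erlang_zero {r : ℝ} (hr : 0 < r) :
    IsProbabilityMeasure (halfLineMeasure (erlangPDF r 0)) := by
  rw [← expMeasure_eq_erlang]; exact isProbabilityMeasure_expMeasure hr

theorem setLIntegral_Ioi_sub_left {x : ℝ} (F : ℝ → ENNReal) :
    ∫⁻ y in Set.Ioi 0, F (x + y) = ∫⁻ s in Set.Ioi x, F s := by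
  rw [← lintegral_indicator measurableSet_Ioi, ← lintegral_indicator measurableSet_Ioi,
    ← lintegral_add_left_eq_self (μ := volume) ((Set.Ioi x).indicator F) x]
  congr 1; ext y
  simp [Set.indicator]

/-- The exponentials multiply to `e^(-rs)`, free of `x`, and only `∫ x^k` remains. -/
theorem erlang_convolution_integral (r : ℝ) (k : ℕ) (s : ℝ) :
    ∫ x in (0 : ℝ)..s, erlangPDF r k x * erlangPDF r 0 (s - x) = erlangPDF r (k + 1) s := by
  have : ∀ x, erlangPDF r k x * erlangPDF r 0 (s - x)
      = r ^ (k + 2) / k.factorial * Real.exp (-(r * s)) * x ^ k := by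
    intro x
    have : Real.exp (-(r * s)) = Real.exp (-(r * x)) * Real.exp (-(r * (s - x))) := by
      rw [← Real.exp_add]; congr 1; ring
    rw [this]; simp only [erlangPDF]; simp; ring
  simp_rw [this]
  rw [intervalIntegral.integral_const_mul, integral_pow]
  simp only [erlangPDF, Nat.factorial_succ]; push_cast
  have : (k.factorial : ℝ) ≠ 0 := by positivity
  field_simp
  simp

theorem erlang_conv {r : ℝ} (hr : 0 < r) (k : ℕ) :
    halfLineMeasure (erlangPDF r k) ∗ halfLineMeasure (erlangPDF r 0)
      = halfLineMeasure (erlangPDF r (k + 1)) := by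
  have := isProbabilityMeasure_erlang_zero hr
  have mk := measurable_erlangPDF r k
  have m0 := measurable_erlangPDF r 0
  refine Measure.ext_of_lintegral _ fun F hF => ?_
  rw [Measure.lintegral_conv hF, lintegral_halfLineMeasure mk,
    lintegral_halfLineMeasure (measurable_erlangPDF r (k + 1))]
  have h1 : ∀ x, ∫⁻ y, F (x + y) ∂halfLineMeasure (erlangPDF r 0)
      = ∫⁻ s in Set.Ioi x, ENNReal.ofReal (erlangPDF r 0 (s - x)) * F s := by
    intro x
    rw [lintegral_halfLineMeasure m0,
      ← setLIntegral_Ioi_sub_left fun s => ENNReal.ofReal (erlangPDF r 0 (s - x)) * F s]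
    simp
  simp_rw [h1]
  -- The constraint `x < s` moves into the integrand, so that the domain becomes a product and
  -- Tonelli applies.
  have h2 : ∀ x ∈ Set.Ioi (0 : ℝ), ENNReal.ofReal (erlangPDF r k x) *
        ∫⁻ s in Set.Ioi x, ENNReal.ofReal (erlangPDF r 0 (s - x)) * F s
      = ∫⁻ s in Set.Ioi 0, (if x < s then ENNReal.ofReal (erlangPDF r k x) *
          (ENNReal.ofReal (erlangPDF r 0 (s - x)) * F s) else 0) := by
    intro x hx
    rw [← lintegral_const_mul _ (by fun_prop), ← lintegral_indicator measurableSet_Ioi,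
      ← lintegral_indicator measurableSet_Ioi]
    congr 1; ext s
    simp only [Set.indicator, Set.mem_Ioi] at hx ⊢
    by_cases h : x < s
    · simp [h, hx.trans h]
    · simp [h]
  rw [setLIntegral_congr_fun measurableSet_Ioi h2, lintegral_lintegral_swap]
  · refine setLIntegral_congr_fun measurableSet_Ioi fun s hs => ?_
    have h3 : ∀ x, (if x < s then ENNReal.ofReal (erlangPDF r k x) *
          (ENNReal.ofReal (erlangPDF r 0 (s - x)) * F s) else 0)
        = (Set.Iio s).indicator (fun x => ENNReal.ofReal (erlangPDF r k x) *
          ENNReal.ofReal (erlangPDF r 0 (s - x))) x * F s := by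
      intro x; by_cases h : x < s <;> simp [h, mul_assoc]
    simp_rw [h3]
    rw [lintegral_mul_const _ (by fun_prop (disch := measurability)),
      lintegral_indicator measurableSet_Iio, Measure.restrict_restrict measurableSet_Iio,
      Set.Iio_inter_Ioi, ← erlang_convolution_integral, ← lintegral_ofReal_Ioo hs.le]
    · congr 1
      refine setLIntegral_congr_fun measurableSet_Ioo fun x hx => ?_
      rw [ENNReal.ofReal_mul (erlangPDF_nonneg hr hx.1.le k)]
    · have := continuous_erlangPDF r k
      have := continuous_erlangPDF r 0
      fun_prop
    · intro x hx
      exact mul_nonneg (erlangPDF_nonneg hr hx.1.le k)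
        (erlangPDF_nonneg hr (sub_nonneg.2 hx.2.le) 0)
  · refine Measurable.aemeasurable ?_
    refine Measurable.ite (measurableSet_lt measurable_fst measurable_snd) ?_ measurable_const
    fun_prop

/-! ### Epochs of a counting process with exponential intertimes -/

theorem epoch_succ (d : ℕ → ℝ) (n : ℕ) : epoch d (n + 1) = epoch d n + d n :=
  Finset.sum_range_succ _ _

theorem epoch_zero (d : ℕ → ℝ) : epoch d 0 = 0 := Finset.sum_range_zero _

@[fun_prop]
theorem measurable_epoch (n : ℕ) : Measurable fun d : ℕ → ℝ => epoch d n := by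
  unfold epoch; fun_prop

theorem indepFun_epoch {Ω : Type*} [MeasurableSpace Ω] {P : Measure Ω} {X : ℕ → Ω → ℝ}
    (hX : ∀ n, AEMeasurable (X n) P) (hind : iIndepFun X P) (n : ℕ) :
    IndepFun (fun ω => epoch (fun m => X m ω) n) (X n) P := by
  have := hind.indepFun_finsetSum_of_notMem₀ hX (s := Finset.range n) (i := n) (by simp)
  convert this using 1
  ext ω; simp [epoch]

theorem hasLaw_epoch {Ω : Type*} [MeasurableSpace Ω] {P : Measure Ω} {X : ℕ → Ω → ℝ} {r : ℝ}
    (hr : 0 < r) (hX : ∀ n, HasLaw (X n) (expMeasure r) P) (hind : iIndepFun X P) (n : ℕ) :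
    HasLaw (fun ω => epoch (fun m => X m ω) (n + 1)) (halfLineMeasure (erlangPDF r n)) P := by
  have := isProbabilityMeasure_expMeasure hr
  have : IsProbabilityMeasure P := (hX 0).isProbabilityMeasure
  induction n with
  | zero => simpa [epoch_succ, epoch_zero, ← expMeasure_eq_erlang] using hX 0
  | succ n ih =>
    rw [← erlang_conv hr, ← expMeasure_eq_erlang]
    have : IsProbabilityMeasure (halfLineMeasure (erlangPDF r n)) :=
      ih.isProbabilityMeasure_iff.1 inferInstance
    have := (indepFun_epoch (fun n => (hX n).aemeasurable) hind (n + 1)).hasLaw_add ih (hX (n + 1))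
    refine this.congr (Filter.Eventually.of_forall fun ω => ?_)
    simp [epoch_succ _ (n + 1)]

theorem ae_halfLineMeasure_pos (f : ℝ → ℝ) : ∀ᵐ x ∂(halfLineMeasure f), 0 < x :=
  (withDensity_absolutelyContinuous _ _).ae_le (ae_restrict_mem measurableSet_Ioi)

theorem ae_expMeasure_pos (r : ℝ) : ∀ᵐ x ∂(expMeasure r), 0 < x := by
  rw [expMeasure_eq_halfLineMeasure]; exact ae_halfLineMeasure_pos _

theorem isProbabilityMeasure_erlang {r : ℝ} (hr : 0 < r) (k : ℕ) :
    IsProbabilityMeasure (halfLineMeasure (erlangPDF r k)) := by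
  have := isProbabilityMeasure_erlang_zero hr
  induction k with
  | zero => exact this
  | succ k ih => rw [← erlang_conv hr]; infer_instance

theorem lintegral_erlangPDF {r : ℝ} (hr : 0 < r) (k : ℕ) :
    ∫⁻ x in Set.Ioi 0, ENNReal.ofReal (erlangPDF r k x) = 1 := by
  have := isProbabilityMeasure_erlang hr k
  have h := lintegral_halfLineMeasure (measurable_erlangPDF r k) fun _ => 1
  simpa using h.symm

theorem setLIntegral_Ioi_mul {a : ℝ} (ha : 0 < a) (F : ℝ → ENNReal) :
    ∫⁻ y in Set.Ioi 0, F y = ∫⁻ s in Set.Ioi 0, ENNReal.ofReal a * F (a * s) := by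
  have h := lintegral_image_eq_lintegral_abs_deriv_mul (s := Set.Ioi (0 : ℝ)) (f := fun s => a * s)
    (f' := fun _ => a) measurableSet_Ioi
    (fun x _ => by simpa using ((hasDerivAt_id x).const_mul a).hasDerivWithinAt)
    (fun x _ y _ h => mul_left_cancel₀ ha.ne' h) F
  rw [abs_of_pos ha] at h
  rw [← h]
  congr 2
  ext x
  simp only [Set.mem_Ioi, Set.mem_image]
  exact ⟨fun hx => ⟨x / a, div_pos hx ha, by field_simp⟩, fun ⟨y, hy, h⟩ => h ▸ mul_pos ha hy⟩

/-! ### The geometric counting process -/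

/-- The density of the `(k + 1)`-st epoch of a geometric counting process. -/
noncomputable def gcpEpochPDF (lam : ℝ) (k : ℕ) (s : ℝ) : ℝ :=
  (k + 1) * lam ^ (k + 1) * s ^ k / (1 + lam * s) ^ (k + 2)

@[fun_prop]
theorem measurable_gcpEpochPDF (lam : ℝ) (k : ℕ) : Measurable (gcpEpochPDF lam k) := by
  unfold gcpEpochPDF; fun_prop

theorem gcpEpochPDF_nonneg {lam s : ℝ} (hlam : 0 < lam) (hs : 0 ≤ s) (k : ℕ) :
    0 ≤ gcpEpochPDF lam k s := by
  unfold gcpEpochPDF; positivity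

/-- As a function of the intensity `a`, the integrand is a multiple of an Erlang density of rate `s
+ 1/λ`, whose total mass is one. -/
theorem gcp_mixture_integral {lam s : ℝ} (hlam : 0 < lam) (hs : 0 < s) (k : ℕ) :
    ∫⁻ a in Set.Ioi 0, ENNReal.ofReal (erlangPDF lam⁻¹ 0 a * (a * erlangPDF 1 k (a * s)))
      = ENNReal.ofReal (gcpEpochPDF lam k s) := by
  have h : ∀ a, erlangPDF lam⁻¹ 0 a * (a * erlangPDF 1 k (a * s))
      = gcpEpochPDF lam k s * erlangPDF (s + lam⁻¹) (k + 1) a := by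
    intro a
    have : Real.exp (-((s + lam⁻¹) * a)) = Real.exp (-(lam⁻¹ * a)) * Real.exp (-(1 * (a * s))) := by
      rw [← Real.exp_add]; congr 1; ring
    simp only [erlangPDF, gcpEpochPDF, this, Nat.factorial_succ]
    have h1 : s + lam⁻¹ = (1 + lam * s) / lam := by field_simp; ring
    rw [h1]
    have : (k.factorial : ℝ) ≠ 0 := by positivity
    have : 1 + lam * s ≠ 0 := by positivity
    push_cast
    generalize Real.exp (-(lam⁻¹ * a)) = A
    generalize Real.exp (-(1 * (a * s))) = B
    rw [div_pow]
    field_simp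
    ring
  simp_rw [h, ENNReal.ofReal_mul (gcpEpochPDF_nonneg hlam hs.le k)]
  rw [lintegral_const_mul _ (by have := measurable_erlangPDF (s + lam⁻¹) (k + 1); fun_prop),
    lintegral_erlangPDF (by positivity), mul_one]

/-- Given the intensity `a`, the quotient has density `a * erlangPDF 1 k (a * s)`; averaging over
`a` is `gcp_mixture_integral`. -/
theorem map_div_prod_erlang {lam : ℝ} (hlam : 0 < lam) (k : ℕ) :
    ((expMeasure lam⁻¹).prod (halfLineMeasure (erlangPDF 1 k))).map (fun p => p.2 / p.1)
      = halfLineMeasure (gcpEpochPDF lam k) := by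
  have := isProbabilityMeasure_erlang one_pos k
  have := isProbabilityMeasure_erlang_zero (inv_pos.2 hlam)
  have m0 := measurable_erlangPDF lam⁻¹ 0
  have m1 := measurable_erlangPDF 1 k
  rw [expMeasure_eq_erlang]
  refine Measure.ext_of_lintegral _ fun F hF => ?_
  rw [lintegral_map hF (by fun_prop), lintegral_prod _ (by fun_prop),
    lintegral_halfLineMeasure m0, lintegral_halfLineMeasure (measurable_gcpEpochPDF lam k)]
  have h1 : ∀ a ∈ Set.Ioi (0 : ℝ), ENNReal.ofReal (erlangPDF lam⁻¹ 0 a) *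
        ∫⁻ y, F (y / a) ∂halfLineMeasure (erlangPDF 1 k)
      = ∫⁻ s in Set.Ioi 0,
          ENNReal.ofReal (erlangPDF lam⁻¹ 0 a * (a * erlangPDF 1 k (a * s))) * F s := by
    intro a ha
    rw [lintegral_halfLineMeasure m1, setLIntegral_Ioi_mul ha,
      ← lintegral_const_mul _ (by fun_prop)]
    refine setLIntegral_congr_fun measurableSet_Ioi fun s hs => ?_
    rw [mul_div_cancel_left₀ _ (ne_of_gt ha), ENNReal.ofReal_mul
      (erlangPDF_nonneg (inv_pos.2 hlam) (le_of_lt ha) 0), ENNReal.ofReal_mul (le_of_lt ha)]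
    ring
  rw [setLIntegral_congr_fun measurableSet_Ioi h1, lintegral_lintegral_swap]
  · refine setLIntegral_congr_fun measurableSet_Ioi fun s hs => ?_
    rw [lintegral_mul_const _ (by fun_prop), gcp_mixture_integral hlam hs]
  · exact Measurable.aemeasurable (by fun_prop)

theorem isProbabilityMeasure_gcp {lam : ℝ} (hlam : 0 < lam) :
    IsProbabilityMeasure (gcpIntertimeLaw lam) := by
  have := isProbabilityMeasure_expMeasure (inv_pos.2 hlam)
  have := isProbabilityMeasure_expMeasure one_pos
  exact Measure.isProbabilityMeasure_map (by fun_prop)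

theorem epoch_div (d : ℕ → ℝ) (a : ℝ) (n : ℕ) : epoch (fun k => d k / a) n = epoch d n / a := by
  simp [epoch, Finset.sum_div]

/-- All intertimes are divided by the same random intensity, so the epoch is an Erlang variable
divided by that intensity. -/
theorem map_epoch_gcp {lam : ℝ} (hlam : 0 < lam) (k : ℕ) :
    (gcpIntertimeLaw lam).map (fun d => epoch d (k + 1)) = halfLineMeasure (gcpEpochPDF lam k) := by
  have := isProbabilityMeasure_expMeasure (inv_pos.2 hlam)
  have := isProbabilityMeasure_expMeasure one_pos
  have hE : (Measure.infinitePi fun _ : ℕ => expMeasure 1).map (fun d => epoch d (k + 1))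
      = halfLineMeasure (erlangPDF 1 k) := by
    refine (hasLaw_epoch one_pos (X := fun n (d : ℕ → ℝ) => d n) (fun n => ?_) ?_ k).map_eq
    · exact (measurePreserving_eval_infinitePi (fun _ : ℕ => expMeasure 1) n).hasLaw
    · rw [iIndepFun_iff_map_fun_eq_infinitePi_map (by fun_prop)]
      simp [Measure.infinitePi_map_eval]
  have me := measurable_epoch (k + 1)
  rw [← map_div_prod_erlang hlam, ← hE]
  have hp : (expMeasure lam⁻¹).prod ((Measure.infinitePi fun _ : ℕ => expMeasure 1).map
      fun d => epoch d (k + 1)) = ((expMeasure lam⁻¹).prod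
        (Measure.infinitePi fun _ : ℕ => expMeasure 1)).map (Prod.map id fun d => epoch d (k + 1)) := by
    rw [← Measure.map_prod_map _ _ measurable_id me, Measure.map_id]
  rw [hp, gcpIntertimeLaw, Measure.map_map me (by fun_prop), Measure.map_map (by fun_prop)
    (by fun_prop)]
  congr 1
  ext p
  simp [epoch_div]

theorem ae_gcp_pos {lam : ℝ} (hlam : 0 < lam) : ∀ᵐ d ∂(gcpIntertimeLaw lam), ∀ n, 0 < d n := by
  have := isProbabilityMeasure_expMeasure (inv_pos.2 hlam)
  have := isProbabilityMeasure_expMeasure one_pos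
  rw [ae_all_iff]
  intro n
  rw [gcpIntertimeLaw, ae_map_iff (by fun_prop) (measurableSet_lt measurable_const (by fun_prop))]
  have h1 : ∀ᵐ p ∂((expMeasure lam⁻¹).prod (Measure.infinitePi fun _ : ℕ => expMeasure 1)),
      0 < p.1 := Measure.quasiMeasurePreserving_fst.ae (ae_expMeasure_pos _)
  have h2 : ∀ᵐ p ∂((expMeasure lam⁻¹).prod (Measure.infinitePi fun _ : ℕ => expMeasure 1)),
      0 < p.2 n := Measure.quasiMeasurePreserving_snd.ae
    ((measurePreserving_eval_infinitePi (fun _ : ℕ => expMeasure 1) n).quasiMeasurePreserving.ae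
      (ae_expMeasure_pos _))
  filter_upwards [h1, h2] with p hp1 hp2 using div_pos hp2 hp1

/-- The right-hand side, as a function of `s`, is an antiderivative of `gcpEpochPDF` that vanishes
at `0`. -/
theorem gcp_epoch_succ_le {lam s : ℝ} (hlam : 0 < lam) (hs : 0 ≤ s) (k : ℕ) :
    gcpIntertimeLaw lam {d | epoch d (k + 1) ≤ s}
      = ENNReal.ofReal ((lam * s / (1 + lam * s)) ^ (k + 1)) := by
  have h1 : gcpIntertimeLaw lam {d | epoch d (k + 1) ≤ s}
      = halfLineMeasure (gcpEpochPDF lam k) (Set.Iic s) := by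
    rw [← map_epoch_gcp hlam, Measure.map_apply (measurable_epoch _) measurableSet_Iic]
    rfl
  have hpos : ∀ x ∈ Set.Icc 0 s, 1 + lam * x ≠ 0 := fun x hx => by
    have := hx.1; positivity
  have hc : ContinuousOn (gcpEpochPDF lam k) (Set.Icc 0 s) := by
    unfold gcpEpochPDF
    exact ContinuousOn.div (by fun_prop) (by fun_prop) fun x hx => pow_ne_zero _ (hpos x hx)
  rw [h1, halfLineMeasure, withDensity_apply _ measurableSet_Iic,
    Measure.restrict_restrict measurableSet_Iic, Set.inter_comm, Set.Ioi_inter_Iic,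
    ← restrict_Ioo_eq_restrict_Ioc, lintegral_ofReal_Ioo hs hc
      fun x hx => gcpEpochPDF_nonneg hlam hx.1.le k]
  congr 1
  rw [intervalIntegral.integral_eq_sub_of_hasDerivAt
    (f := fun x => (lam * x / (1 + lam * x)) ^ (k + 1))]
  · simp
  · intro x hx
    rw [Set.uIcc_of_le hs] at hx
    have h0 := hpos x hx
    have hl : HasDerivAt (fun x => lam * x) lam x := by simpa using (hasDerivAt_id x).const_mul lam
    convert! (hl.div (hl.const_add 1) h0).pow (k + 1) using 1
    simp only [gcpEpochPDF, Nat.add_sub_cancel, Pi.div_apply, div_pow]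
    push_cast
    field_simp
    ring
  · rw [← Set.uIcc_of_le hs] at hc; exact hc.intervalIntegrable

theorem epoch_lt_epoch_succ {d : ℕ → ℝ} (hd : ∀ n, 0 < d n) (n : ℕ) :
    epoch d n < epoch d (n + 1) := by
  rw [epoch_succ]; linarith [hd n]

theorem epoch_nonneg {d : ℕ → ℝ} (hd : ∀ n, 0 < d n) (n : ℕ) : 0 ≤ epoch d n :=
  Finset.sum_nonneg fun k _ => (hd k).le

theorem gcp_epoch_le {lam s : ℝ} (hlam : 0 < lam) (hs : 0 ≤ s) (k : ℕ) :
    gcpIntertimeLaw lam {d | epoch d k ≤ s}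
      = ENNReal.ofReal ((lam * s / (1 + lam * s)) ^ k) := by
  have := isProbabilityMeasure_gcp hlam
  cases k with
  | zero => simp [epoch_zero, hs]
  | succ k => exact gcp_epoch_succ_le hlam hs k

/-- The law of the number of epochs up to time `s` is geometric. -/
theorem gcp_count {lam s : ℝ} (hlam : 0 < lam) (hs : 0 ≤ s) (k : ℕ) :
    gcpIntertimeLaw lam {d | epoch d k ≤ s ∧ s < epoch d (k + 1)}
      = ENNReal.ofReal ((lam * s) ^ k / (1 + lam * s) ^ (k + 1)) := by
  have := isProbabilityMeasure_gcp hlam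
  have h1 : {d : ℕ → ℝ | epoch d k ≤ s ∧ s < epoch d (k + 1)}
      = {d | epoch d k ≤ s} \ {d | epoch d (k + 1) ≤ s} := by
    ext d; simp
  have hpos : 0 < 1 + lam * s := by positivity
  have hm : MeasurableSet {d : ℕ → ℝ | epoch d (k + 1) ≤ s} :=
    measurableSet_le (measurable_epoch _) measurable_const
  -- This form of the difference formula requires no inclusion; the inclusion holds only almost
  -- surely, where all intertimes are positive.
  rw [h1, measure_sdiff' _ hm.nullMeasurableSet (measure_ne_top _ _)]
  have h2 : gcpIntertimeLaw lam ({d | epoch d k ≤ s} ∪ {d | epoch d (k + 1) ≤ s})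
      = gcpIntertimeLaw lam {d | epoch d k ≤ s} := by
    refine measure_congr ?_
    filter_upwards [ae_gcp_pos hlam] with d hd
    refine propext ⟨fun h => ?_, fun h => Or.inl h⟩
    rcases h with h | h
    · exact h
    · exact (epoch_lt_epoch_succ hd k).le.trans h
  rw [h2, gcp_epoch_le hlam hs, gcp_epoch_le hlam hs, ← ENNReal.ofReal_sub _ (by positivity)]
  congr 1
  rw [div_pow, div_pow]
  field_simp
  ring

/-- This covers the case where the time already used by the other velocity exceeds `t`. -/
theorem gcp_count_of_neg {lam s : ℝ} (hlam : 0 < lam) (hs : s < 0) (k : ℕ) :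
    gcpIntertimeLaw lam {d | epoch d k ≤ s ∧ s < epoch d (k + 1)} = 0 := by
  rw [← nonpos_iff_eq_zero, ← measure_empty (μ := gcpIntertimeLaw lam)]
  refine measure_mono_ae ?_
  filter_upwards [ae_gcp_pos hlam] with d hd h
  exact absurd (epoch_nonneg hd k) (not_le.2 (h.1.trans_lt hs))

/-! ### Paths of the telegraph process -/

theorem epoch_strictMono {d : ℕ → ℝ} (hd : ∀ n, 0 < d n) : StrictMono (epoch d) :=
  strictMono_nat_of_lt_succ (epoch_lt_epoch_succ hd)

theorem countUpTo_eq {d : ℕ → ℝ} (hd : ∀ n, 0 < d n) {n : ℕ} {t : ℝ} (h1 : epoch d n ≤ t)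
    (h2 : t < epoch d (n + 1)) : countUpTo d t = n := by
  have : {m : ℕ | 1 ≤ m ∧ epoch d m ≤ t} = ↑(Finset.Icc 1 n) := by
    ext m
    simp only [Set.mem_ofPred_eq, Finset.coe_Icc, Set.mem_Icc, and_congr_right_iff]
    intro _
    constructor
    · intro h
      by_contra! hn
      exact absurd h (not_le.2 (h2.trans_le ((epoch_strictMono hd).monotone hn)))
    · exact fun h => ((epoch_strictMono hd).monotone h).trans h1
  rw [countUpTo, this, Set.ncard_coe_finset, Nat.card_Icc, Nat.add_sub_cancel]

/-- The alternating sum of the first `n` terms. -/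
noncomputable def altSum (d : ℕ → ℝ) (n : ℕ) : ℝ := ∑ k ∈ Finset.range n, (-1) ^ k * d k

theorem altSum_succ (d : ℕ → ℝ) (n : ℕ) : altSum d (n + 1) = altSum d n + (-1) ^ n * d n :=
  Finset.sum_range_succ _ _

/-- The right endpoint may be the next epoch: the parity jumps there, but a single point does not
affect the integral. The induction in `integral_parity` uses this endpoint. -/
theorem integral_parity_of_mem {d : ℕ → ℝ} (hd : ∀ n, 0 < d n) {n : ℕ} {t : ℝ}
    (h1 : epoch d n ≤ t) (h2 : t ≤ epoch d (n + 1)) :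
    IntervalIntegrable (fun s => (-1 : ℝ) ^ countUpTo d s) volume (epoch d n) t ∧
      ∫ s in (epoch d n)..t, (-1 : ℝ) ^ countUpTo d s = (-1) ^ n * (t - epoch d n) := by
  have h0 : ∀ᵐ s : ℝ, s ≠ t := by simp [ae_iff]
  have h : ∀ᵐ s : ℝ, s ∈ Set.uIoc (epoch d n) t →
      (-1 : ℝ) ^ n = (-1 : ℝ) ^ countUpTo d s := by
    filter_upwards [h0] with s hs hmem
    rw [Set.uIoc_of_le h1] at hmem
    rw [countUpTo_eq hd hmem.1.le ((lt_of_le_of_ne hmem.2 hs).trans_le h2)]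
  constructor
  · refine (intervalIntegrable_const (c := (-1 : ℝ) ^ n)).congr_ae ?_
    exact (ae_restrict_iff' measurableSet_uIoc).2 h
  · rw [← intervalIntegral.integral_congr_ae h]
    simp [mul_comm]

theorem integral_parity {d : ℕ → ℝ} (hd : ∀ n, 0 < d n) (n : ℕ) : ∀ {t : ℝ},
    epoch d n ≤ t → t ≤ epoch d (n + 1) →
    IntervalIntegrable (fun s => (-1 : ℝ) ^ countUpTo d s) volume 0 t ∧
      ∫ s in (0 : ℝ)..t, (-1 : ℝ) ^ countUpTo d s = altSum d n + (-1) ^ n * (t - epoch d n) := by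
  induction n with
  | zero =>
    intro t h1 h2
    simpa [altSum, epoch_zero] using integral_parity_of_mem hd h1 h2
  | succ n ih =>
    intro t h1 h2
    obtain ⟨i1, e1⟩ := ih (epoch_lt_epoch_succ hd n).le le_rfl
    obtain ⟨i2, e2⟩ := integral_parity_of_mem hd h1 h2
    refine ⟨i1.trans i2, ?_⟩
    rw [← intervalIntegral.integral_add_adjacent_intervals i1 i2, e1, e2, altSum_succ]
    rw [epoch_succ d n]; ring

theorem alternating_pos {d : Fin 2 → ℕ → ℝ} (hd : ∀ i n, 0 < d i n) (j : Fin 2) (n : ℕ) :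
    0 < alternating j d n := by
  unfold alternating; split_ifs <;> exact hd _ _

theorem alternating_even (j : Fin 2) (d : Fin 2 → ℕ → ℝ) (k : ℕ) :
    alternating j d (2 * k) = d j k := by simp [alternating]

theorem alternating_odd (j : Fin 2) (d : Fin 2 → ℕ → ℝ) (k : ℕ) :
    alternating j d (2 * k + 1) = d (1 - j) k := by
  have : (2 * k + 1) / 2 = k := by omega
  simp [alternating, this, parity_simps]

theorem epoch_alternating_even (j : Fin 2) (d : Fin 2 → ℕ → ℝ) (k : ℕ) :
    epoch (alternating j d) (2 * k) = epoch (d j) k + epoch (d (1 - j)) k := by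
  induction k with
  | zero => simp [epoch_zero]
  | succ k ih =>
    rw [show 2 * (k + 1) = 2 * k + 1 + 1 by ring, epoch_succ, epoch_succ, ih, alternating_even,
      alternating_odd, epoch_succ, epoch_succ]
    ring

theorem epoch_alternating_odd (j : Fin 2) (d : Fin 2 → ℕ → ℝ) (k : ℕ) :
    epoch (alternating j d) (2 * k + 1) = epoch (d j) (k + 1) + epoch (d (1 - j)) k := by
  rw [epoch_succ, epoch_alternating_even, alternating_even, epoch_succ]; ring

theorem altSum_alternating_even (j : Fin 2) (d : Fin 2 → ℕ → ℝ) (k : ℕ) :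
    altSum (alternating j d) (2 * k) = epoch (d j) k - epoch (d (1 - j)) k := by
  induction k with
  | zero => simp [epoch_zero, altSum]
  | succ k ih =>
    rw [show 2 * (k + 1) = 2 * k + 1 + 1 by ring, altSum_succ, altSum_succ, ih, alternating_even,
      alternating_odd, epoch_succ, epoch_succ]
    simp [pow_succ, pow_mul]
    ring

theorem altSum_alternating_odd (j : Fin 2) (d : Fin 2 → ℕ → ℝ) (k : ℕ) :
    altSum (alternating j d) (2 * k + 1) = epoch (d j) (k + 1) - epoch (d (1 - j)) k := by
  rw [altSum_succ, altSum_alternating_even, alternating_even, epoch_succ]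
  simp [pow_mul]; ring

/-- With `half_velocity_sub`, this expresses the path through the initial and the other velocity, so
that later arguments need no case distinction on `j`. -/
theorem mean_velocity_add (v : Fin 2 → ℝ) (j : Fin 2) :
    (v 0 + v 1) / 2 = (v j + v (1 - j)) / 2 := by
  fin_cases j
  · simp
  · simp [add_comm]

theorem half_velocity_sub (v : Fin 2 → ℝ) (j : Fin 2) :
    (-1) ^ (j : ℕ) * ((v 0 - v 1) / 2) = (v j - v (1 - j)) / 2 := by
  fin_cases j
  · simp
  · simp; ring

theorem telegraphVelocity_even (v : Fin 2 → ℝ) (j : Fin 2) (d : Fin 2 → ℕ → ℝ) {t : ℝ} {k : ℕ}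
    (h : countUpTo (alternating j d) t = 2 * k) : telegraphVelocity v j d t = v j := by
  rw [telegraphVelocity, h, half_velocity_sub, mean_velocity_add v j]
  simp [pow_mul]; ring

theorem telegraphVelocity_odd (v : Fin 2 → ℝ) (j : Fin 2) (d : Fin 2 → ℕ → ℝ) {t : ℝ} {k : ℕ}
    (h : countUpTo (alternating j d) t = 2 * k + 1) :
    telegraphVelocity v j d t = v (1 - j) := by
  rw [telegraphVelocity, h, half_velocity_sub, mean_velocity_add v j]
  simp [pow_mul, pow_succ]; ring

theorem telegraphPosition_eq (v : Fin 2 → ℝ) (j : Fin 2) {d : Fin 2 → ℕ → ℝ}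
    (hd : ∀ i n, 0 < d i n) {n : ℕ} {t : ℝ} (h1 : epoch (alternating j d) n ≤ t)
    (h2 : t < epoch (alternating j d) (n + 1)) :
    telegraphPosition v j d t = (v j + v (1 - j)) / 2 * t + (v j - v (1 - j)) / 2 *
      (altSum (alternating j d) n + (-1) ^ n * (t - epoch (alternating j d) n)) := by
  obtain ⟨hi, he⟩ := integral_parity (alternating_pos hd j) n h1 h2.le
  unfold telegraphPosition telegraphVelocity
  rw [intervalIntegral.integral_add intervalIntegrable_const (hi.const_mul _),
    intervalIntegral.integral_const_mul, he, half_velocity_sub, mean_velocity_add v j,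
    intervalIntegral.integral_const, smul_eq_mul]
  ring

theorem telegraphPosition_even (v : Fin 2 → ℝ) (j : Fin 2) {d : Fin 2 → ℕ → ℝ}
    (hd : ∀ i n, 0 < d i n) {k : ℕ} {t : ℝ} (h1 : epoch (alternating j d) (2 * k) ≤ t)
    (h2 : t < epoch (alternating j d) (2 * k + 1)) :
    telegraphPosition v j d t
      = v j * (t - epoch (d (1 - j)) k) + v (1 - j) * epoch (d (1 - j)) k := by
  rw [telegraphPosition_eq v j hd h1 h2, altSum_alternating_even, epoch_alternating_even]
  simp [pow_mul]; ring

theorem telegraphPosition_odd (v : Fin 2 → ℝ) (j : Fin 2) {d : Fin 2 → ℕ → ℝ}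
    (hd : ∀ i n, 0 < d i n) {k : ℕ} {t : ℝ} (h1 : epoch (alternating j d) (2 * k + 1) ≤ t)
    (h2 : t < epoch (alternating j d) (2 * k + 1 + 1)) :
    telegraphPosition v j d t
      = v j * epoch (d j) (k + 1) + v (1 - j) * (t - epoch (d j) (k + 1)) := by
  rw [telegraphPosition_eq v j hd h1 h2, altSum_alternating_odd, epoch_alternating_odd]
  simp [pow_mul, pow_succ]; ring

/-! ### The law of the telegraph process without resets -/

/-- The probability that a geometric counting process counts `k` epochs up to time `s`. -/
noncomputable def gcpCountPMF (lam : ℝ) (k : ℕ) (s : ℝ) : ℝ :=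
  (lam * s) ^ k / (1 + lam * s) ^ (k + 1)

theorem gcpCountPMF_nonneg {lam s : ℝ} (hlam : 0 < lam) (hs : 0 ≤ s) (k : ℕ) :
    0 ≤ gcpCountPMF lam k s := by
  unfold gcpCountPMF; positivity

theorem gcp_count_eq {lam : ℝ} (hlam : 0 < lam) (k : ℕ) (s : ℝ) :
    gcpIntertimeLaw lam {d | epoch d k ≤ s ∧ s < epoch d (k + 1)}
      = (Set.Ici 0).indicator (fun s => ENNReal.ofReal (gcpCountPMF lam k s)) s := by
  by_cases hs : 0 ≤ s
  · simpa [hs, gcpCountPMF] using gcp_count hlam hs k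
  · simpa [hs] using gcp_count_of_neg hlam (not_le.1 hs) k

/-- On this event of the sojourn times `p.1` with the initial velocity `a` and `p.2` with the other
velocity `b`, there are `2 k` changes of velocity up to time `t` and the position at time `t` is in
`B`. -/
def evenEvent (a b : ℝ) (B : Set ℝ) (k : ℕ) (t : ℝ) : Set ((ℕ → ℝ) × (ℕ → ℝ)) :=
  {p | (epoch p.1 k ≤ t - epoch p.2 k ∧ t - epoch p.2 k < epoch p.1 (k + 1)) ∧
    a * (t - epoch p.2 k) + b * epoch p.2 k ∈ B}

/-- As `evenEvent`, but with `2 k + 1` changes of velocity. -/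
def oddEvent (a b : ℝ) (B : Set ℝ) (k : ℕ) (t : ℝ) : Set ((ℕ → ℝ) × (ℕ → ℝ)) :=
  {p | (epoch p.2 k ≤ t - epoch p.1 (k + 1) ∧ t - epoch p.1 (k + 1) < epoch p.2 (k + 1)) ∧
    a * epoch p.1 (k + 1) + b * (t - epoch p.1 (k + 1)) ∈ B}

theorem measurableSet_evenEvent_graph (a b : ℝ) {B : Set ℝ} (hB : MeasurableSet B) (k : ℕ) :
    MeasurableSet {q : ℝ × ((ℕ → ℝ) × (ℕ → ℝ)) | q.2 ∈ evenEvent a b B k q.1} := by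
  refine MeasurableSet.inter (MeasurableSet.inter ?_ ?_) ?_
  · exact measurableSet_le (f := fun q : ℝ × ((ℕ → ℝ) × (ℕ → ℝ)) => epoch q.2.1 k)
      (by fun_prop) (by fun_prop)
  · exact measurableSet_lt (f := fun q : ℝ × ((ℕ → ℝ) × (ℕ → ℝ)) => q.1 - epoch q.2.2 k)
      (by fun_prop) (by fun_prop)
  · exact measurableSet_preimage (f := fun q : ℝ × ((ℕ → ℝ) × (ℕ → ℝ)) =>
      a * (q.1 - epoch q.2.2 k) + b * epoch q.2.2 k) (by fun_prop) hB

theorem measurableSet_oddEvent_graph (a b : ℝ) {B : Set ℝ} (hB : MeasurableSet B) (k : ℕ) :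
    MeasurableSet {q : ℝ × ((ℕ → ℝ) × (ℕ → ℝ)) | q.2 ∈ oddEvent a b B k q.1} := by
  refine MeasurableSet.inter (MeasurableSet.inter ?_ ?_) ?_
  · exact measurableSet_le (f := fun q : ℝ × ((ℕ → ℝ) × (ℕ → ℝ)) => epoch q.2.2 k)
      (by fun_prop) (by fun_prop)
  · exact measurableSet_lt (f := fun q : ℝ × ((ℕ → ℝ) × (ℕ → ℝ)) => q.1 - epoch q.2.1 (k + 1))
      (by fun_prop) (by fun_prop)
  · exact measurableSet_preimage (f := fun q : ℝ × ((ℕ → ℝ) × (ℕ → ℝ)) =>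
      a * epoch q.2.1 (k + 1) + b * (q.1 - epoch q.2.1 (k + 1))) (by fun_prop) hB

theorem measurableSet_evenEvent (a b : ℝ) {B : Set ℝ} (hB : MeasurableSet B) (k : ℕ) (t : ℝ) :
    MeasurableSet (evenEvent a b B k t) :=
  measurable_prodMk_left (measurableSet_evenEvent_graph a b hB k)

theorem measurableSet_oddEvent (a b : ℝ) {B : Set ℝ} (hB : MeasurableSet B) (k : ℕ) (t : ℝ) :
    MeasurableSet (oddEvent a b B k t) :=
  measurable_prodMk_left (measurableSet_oddEvent_graph a b hB k)

/-- One GCP enters only through its `(k + 1)`-st epoch `s`, which has a density; the other must then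
count `m` epochs in `t - s`, which is impossible for `s > t`. -/
theorem lintegral_gcp_epoch {lam : ℝ} (hlam : 0 < lam) (k m : ℕ) (t : ℝ) {F : ℝ → ENNReal}
    (hF : Measurable F) :
    ∫⁻ y, gcpIntertimeLaw lam {d | epoch d m ≤ t - epoch y (k + 1) ∧
        t - epoch y (k + 1) < epoch d (m + 1)} * F (epoch y (k + 1)) ∂(gcpIntertimeLaw lam)
      = ∫⁻ s in Set.Ioo 0 t,
          ENNReal.ofReal (gcpEpochPDF lam k s * gcpCountPMF lam m (t - s)) * F s := by
  have mc : Measurable (gcpCountPMF lam m) := by unfold gcpCountPMF; fun_prop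
  have mi : Measurable fun s =>
      (Set.Ici 0).indicator (fun s => ENNReal.ofReal (gcpCountPMF lam m s)) s :=
    Measurable.indicator (by fun_prop) measurableSet_Ici
  simp_rw [gcp_count_eq hlam]
  have h := lintegral_map (μ := gcpIntertimeLaw lam)
    (f := fun s => (Set.Ici 0).indicator (fun s => ENNReal.ofReal (gcpCountPMF lam m s)) (t - s)
      * F s) (g := fun d => epoch d (k + 1)) (by fun_prop) (by fun_prop)
  rw [← h, map_epoch_gcp hlam, lintegral_halfLineMeasure (by fun_prop), restrict_Ioo_eq_restrict_Ioc,
    ← lintegral_indicator measurableSet_Ioi, ← lintegral_indicator measurableSet_Ioc]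
  congr 1; ext s
  by_cases h0 : 0 < s
  · by_cases h1 : s ≤ t
    · simp [h0, h1, ENNReal.ofReal_mul (gcpEpochPDF_nonneg hlam h0.le k), mul_assoc]
    · simp [h1]
  · simp [h0]

/-- The outer integral stays unevaluated because for `k = 0` the epoch is the constant `0` and has
no density. -/
theorem measure_evenEvent {lam : ℝ} (hlam : 0 < lam) (a b : ℝ) {B : Set ℝ} (hB : MeasurableSet B)
    (k : ℕ) (t : ℝ) :
    ((gcpIntertimeLaw lam).prod (gcpIntertimeLaw lam)) (evenEvent a b B k t)
      = ∫⁻ y, gcpIntertimeLaw lam {d | epoch d k ≤ t - epoch y k ∧ t - epoch y k < epoch d (k + 1)}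
        * B.indicator 1 (a * (t - epoch y k) + b * epoch y k) ∂(gcpIntertimeLaw lam) := by
  have := isProbabilityMeasure_gcp hlam
  rw [Measure.prod_apply_symm (measurableSet_evenEvent a b hB k t)]
  refine lintegral_congr fun y => ?_
  by_cases h : a * (t - epoch y k) + b * epoch y k ∈ B <;> simp [evenEvent, h, Set.preimage]

theorem measure_oddEvent {lam : ℝ} (hlam : 0 < lam) (a b : ℝ) {B : Set ℝ} (hB : MeasurableSet B)
    (k : ℕ) (t : ℝ) :
    ((gcpIntertimeLaw lam).prod (gcpIntertimeLaw lam)) (oddEvent a b B k t)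
      = ∫⁻ s in Set.Ioo 0 t, ENNReal.ofReal (gcpEpochPDF lam k s * gcpCountPMF lam k (t - s))
          * B.indicator 1 (a * s + b * (t - s)) := by
  have := isProbabilityMeasure_gcp hlam
  have hm : Measurable fun s : ℝ => B.indicator (1 : ℝ → ENNReal) (a * s + b * (t - s)) :=
    (measurable_one.indicator hB).comp (by fun_prop)
  rw [Measure.prod_apply (measurableSet_oddEvent a b hB k t), ← lintegral_gcp_epoch hlam k k t hm]
  refine lintegral_congr fun y => ?_
  by_cases h : a * epoch y (k + 1) + b * (t - epoch y (k + 1)) ∈ B <;>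
    simp [oddEvent, h, Set.preimage]

/-- The series is a multiple of `∑ (k + 1) q^k = (1 - q)⁻²`, where `q` is the product of the
geometric ratios of the two counts and `1 - q` factors. -/
theorem hasSum_gcp_odd {lam s u : ℝ} (hlam : 0 < lam) (hs : 0 < s) (hu : 0 < u) :
    HasSum (fun k => gcpEpochPDF lam k s * gcpCountPMF lam k u)
      (lam * (1 + lam * u) / (1 + lam * (s + u)) ^ 2) := by
  have h1 : 0 < 1 + lam * s := by positivity
  have h2 : 0 < 1 + lam * u := by positivity
  have h3 : 0 < 1 + lam * (s + u) := by positivity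
  set q := lam * s * (lam * u) / ((1 + lam * s) * (1 + lam * u)) with hq
  have hq0 : 0 ≤ q := by positivity
  have e1 : 1 - q = (1 + lam * (s + u)) / ((1 + lam * s) * (1 + lam * u)) := by
    rw [hq]; field_simp; ring
  have hq1 : q < 1 := by
    have : 0 < 1 - q := by rw [e1]; positivity
    linarith
  have hn : ‖q‖ < 1 := by rwa [Real.norm_of_nonneg hq0]
  have h := (hasSum_choose_mul_geometric_of_norm_lt_one 1 hn).mul_left
    (lam / ((1 + lam * s) ^ 2 * (1 + lam * u)))
  convert! h using 1
  · ext k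
    simp only [gcpEpochPDF, gcpCountPMF, hq, Nat.choose_one_right, div_pow, mul_pow]
    push_cast
    field_simp
    ring
  · rw [e1, div_pow]; field_simp; ring

/-- Each term is the odd one times `λu / (1 + λu)`, for the additional epoch counted in time `u`. -/
theorem hasSum_gcp_even {lam s u : ℝ} (hlam : 0 < lam) (hs : 0 < s) (hu : 0 < u) :
    HasSum (fun k => gcpEpochPDF lam k s * gcpCountPMF lam (k + 1) u)
      (lam ^ 2 * u / (1 + lam * (s + u)) ^ 2) := by
  have h2 : 0 < 1 + lam * u := by positivity
  have h3 : 0 < 1 + lam * (s + u) := by positivity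
  have h := (hasSum_gcp_odd hlam hs hu).mul_right (lam * u / (1 + lam * u))
  convert! h using 1
  · ext k
    simp only [gcpCountPMF]
    field_simp
    ring
  · field_simp

/-- The mass that the law of the telegraph process at time `t` gives to `B`, on the event that the
velocity at time `t` is the initial velocity `a`; the other velocity is `b`. -/
noncomputable def evenMass (lam a b : ℝ) (B : Set ℝ) (t : ℝ) : ENNReal :=
  ENNReal.ofReal (1 / (1 + lam * t)) * B.indicator 1 (a * t)
    + ∫⁻ s in Set.Ioo 0 t, ENNReal.ofReal (lam ^ 2 * (t - s) / (1 + lam * t) ^ 2)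
      * B.indicator 1 (a * (t - s) + b * s)

/-- As `evenMass`, on the event that the velocity at time `t` is not the initial velocity. -/
noncomputable def oddMass (lam a b : ℝ) (B : Set ℝ) (t : ℝ) : ENNReal :=
  ∫⁻ s in Set.Ioo 0 t, ENNReal.ofReal (lam * (1 + lam * (t - s)) / (1 + lam * t) ^ 2)
      * B.indicator 1 (a * s + b * (t - s))

theorem tsum_ofReal_eq {f : ℕ → ℝ} {x : ℝ} (h0 : ∀ k, 0 ≤ f k) (h : HasSum f x) :
    ∑' k, ENNReal.ofReal (f k) = ENNReal.ofReal x := by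
  rw [← ENNReal.ofReal_tsum_of_nonneg h0 h.summable, h.tsum_eq]

theorem tsum_measure_oddEvent {lam : ℝ} (hlam : 0 < lam) (a b : ℝ) {B : Set ℝ}
    (hB : MeasurableSet B) (t : ℝ) :
    ∑' k, ((gcpIntertimeLaw lam).prod (gcpIntertimeLaw lam)) (oddEvent a b B k t)
      = oddMass lam a b B t := by
  have hm : Measurable fun s : ℝ => B.indicator (1 : ℝ → ENNReal) (a * s + b * (t - s)) :=
    (measurable_one.indicator hB).comp (by fun_prop)
  have mc : ∀ m, Measurable (gcpCountPMF lam m) := fun m => by unfold gcpCountPMF; fun_prop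
  simp_rw [measure_oddEvent hlam a b hB]
  rw [← lintegral_tsum fun k => Measurable.aemeasurable (by fun_prop), oddMass]
  refine setLIntegral_congr_fun measurableSet_Ioo fun s hs => ?_
  rw [ENNReal.tsum_mul_right, tsum_ofReal_eq (fun k => mul_nonneg (gcpEpochPDF_nonneg hlam hs.1.le k)
    (gcpCountPMF_nonneg hlam (sub_nonneg.2 hs.2.le) k)) (hasSum_gcp_odd hlam hs.1 (sub_pos.2 hs.2))]
  simp

theorem tsum_measure_evenEvent {lam : ℝ} (hlam : 0 < lam) (a b : ℝ) {B : Set ℝ}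
    (hB : MeasurableSet B) {t : ℝ} (ht : 0 ≤ t) :
    ∑' k, ((gcpIntertimeLaw lam).prod (gcpIntertimeLaw lam)) (evenEvent a b B k t)
      = evenMass lam a b B t := by
  have := isProbabilityMeasure_gcp hlam
  have hm : Measurable fun s : ℝ => B.indicator (1 : ℝ → ENNReal) (a * (t - s) + b * s) :=
    (measurable_one.indicator hB).comp (by fun_prop)
  have mc : ∀ m, Measurable (gcpCountPMF lam m) := fun m => by unfold gcpCountPMF; fun_prop
  simp_rw [measure_evenEvent hlam a b hB]
  -- The term `k = 0`, without any turn, is the atom; the index shift pairs the `(k + 1)`-st epoch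
  -- with a count of `k + 1`.
  rw [tsum_eq_zero_add' ENNReal.summable, evenMass]
  congr 1
  · simp only [epoch_zero, sub_zero, mul_zero, add_zero, lintegral_const, measure_univ, mul_one]
    have := gcp_count hlam ht 0
    simp only [epoch_zero] at this
    rw [this]
    simp
  · simp_rw [lintegral_gcp_epoch hlam _ _ t hm]
    rw [← lintegral_tsum fun k => Measurable.aemeasurable (by fun_prop)]
    refine setLIntegral_congr_fun measurableSet_Ioo fun s hs => ?_
    rw [ENNReal.tsum_mul_right,
      tsum_ofReal_eq (fun k => mul_nonneg (gcpEpochPDF_nonneg hlam hs.1.le k)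
        (gcpCountPMF_nonneg hlam (sub_nonneg.2 hs.2.le) (k + 1)))
        (hasSum_gcp_even hlam hs.1 (sub_pos.2 hs.2))]
    simp

/-- This normalization later replaces a proof that the epochs almost surely tend to infinity. -/
theorem evenMass_univ_add_oddMass_univ {lam : ℝ} (hlam : 0 < lam) (a b : ℝ) {t : ℝ} (ht : 0 ≤ t) :
    evenMass lam a b Set.univ t + oddMass lam a b Set.univ t = 1 := by
  have hpos : 0 < 1 + lam * t := by positivity
  have h1 : ∀ s ∈ Set.Ioo 0 t, 0 ≤ lam ^ 2 * (t - s) / (1 + lam * t) ^ 2 := fun s hs => by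
    have := sub_nonneg.2 hs.2.le; positivity
  have h2 : ∀ s ∈ Set.Ioo 0 t, 0 ≤ lam * (1 + lam * (t - s)) / (1 + lam * t) ^ 2 := fun s hs => by
    have := sub_nonneg.2 hs.2.le; positivity
  simp only [evenMass, oddMass, Set.indicator_univ, Pi.one_apply, mul_one]
  rw [add_assoc, ← lintegral_add_left (by fun_prop)]
  rw [setLIntegral_congr_fun (g := fun s => ENNReal.ofReal (lam ^ 2 * (t - s) / (1 + lam * t) ^ 2
    + lam * (1 + lam * (t - s)) / (1 + lam * t) ^ 2)) measurableSet_Ioo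
    fun s hs => (ENNReal.ofReal_add (h1 s hs) (h2 s hs)).symm,
    lintegral_ofReal_Ioo ht (by fun_prop) fun s hs => add_nonneg (h1 s hs) (h2 s hs)]
  have hi : ∫ s in (0 : ℝ)..t, (lam ^ 2 * (t - s) / (1 + lam * t) ^ 2
      + lam * (1 + lam * (t - s)) / (1 + lam * t) ^ 2) = lam * t / (1 + lam * t) := by
    have : ∀ s, lam ^ 2 * (t - s) / (1 + lam * t) ^ 2 + lam * (1 + lam * (t - s)) / (1 + lam * t) ^ 2
        = (2 * lam ^ 2 * t + lam) / (1 + lam * t) ^ 2 - 2 * lam ^ 2 / (1 + lam * t) ^ 2 * s := by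
      intro s; ring
    simp_rw [this]
    rw [intervalIntegral.integral_sub (by simp) (Continuous.intervalIntegrable (by fun_prop) _ _),
      intervalIntegral.integral_const_mul, integral_id, intervalIntegral.integral_const, smul_eq_mul]
    field_simp
    ring
  rw [hi, ← ENNReal.ofReal_add (by positivity) (by positivity), ← ENNReal.ofReal_one]
  congr 1
  field_simp

/-! ### The age at time `t` of a Poisson process -/

theorem expMeasure_Ioi {r x : ℝ} (hr : 0 < r) (hx : 0 ≤ x) :
    expMeasure r (Set.Ioi x) = ENNReal.ofReal (Real.exp (-r * x)) := by
  have := isProbabilityMeasure_expMeasure hr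
  rw [← Set.compl_Iic, prob_compl_eq_one_sub measurableSet_Iic, ← ofReal_cdf, cdf_expMeasure_eq hr,
    if_pos hx, ← ENNReal.ofReal_one, ← ENNReal.ofReal_sub]
  · congr 1; rw [neg_mul]; ring
  · rw [sub_nonneg, Real.exp_le_one_iff]; nlinarith

/-- The exponential series: the renewal density of the Poisson process is constant. -/
theorem hasSum_erlangPDF (r s : ℝ) : HasSum (fun k => erlangPDF r k s) r := by
  have h := ((NormedSpace.expSeries_div_hasSum_exp (r * s)).mul_left r).mul_right
    (Real.exp (-(r * s)))
  rw [← Real.exp_eq_exp_ℝ, mul_assoc, ← Real.exp_add, add_neg_cancel, Real.exp_zero, mul_one] at h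
  refine h.congr_fun ?_
  intro k; simp only [erlangPDF]; ring

theorem setLIntegral_Ioo_reflect (t : ℝ) (F : ℝ → ENNReal) :
    ∫⁻ s in Set.Ioo 0 t, F (t - s) = ∫⁻ a in Set.Ioo 0 t, F a := by
  rw [← lintegral_indicator measurableSet_Ioo, ← lintegral_indicator measurableSet_Ioo,
    ← lintegral_sub_left_eq_self (μ := volume) ((Set.Ioo 0 t).indicator F) t]
  congr 1; ext s
  simp [Set.indicator, and_comm]

/-- The value of `f` at the age at time `t` of an epoch `w.1` that is followed by an intertime `w.2`,
if `t` lies in this intertime, and `0` otherwise. -/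
noncomputable def ageValue (f : ℝ → ENNReal) (t : ℝ) : ℝ × ℝ → ENNReal :=
  {w : ℝ × ℝ | w.1 ≤ t ∧ t < w.1 + w.2}.indicator fun w => f (t - w.1)

theorem measurableSet_age (t : ℝ) : MeasurableSet {w : ℝ × ℝ | w.1 ≤ t ∧ t < w.1 + w.2} :=
  MeasurableSet.inter (measurableSet_le measurable_fst measurable_const)
    (measurableSet_lt measurable_const (measurable_fst.add measurable_snd))

theorem measurable_ageValue {f : ℝ → ENNReal} (hf : Measurable f) (t : ℝ) :
    Measurable (ageValue f t) :=
  Measurable.indicator (by fun_prop) (measurableSet_age t)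

section Age

variable {Ω : Type*} [MeasurableSpace Ω] {P : Measure Ω} {R : ℕ → Ω → ℝ} {xi : ℝ}

theorem aemeasurable_epoch (hR : ∀ m, AEMeasurable (R m) P) (m : ℕ) :
    AEMeasurable (fun ω => epoch (fun m => R m ω) m) P :=
  (measurable_epoch m).comp_aemeasurable (aemeasurable_pi_lambda _ hR)

/-- The `m`-th epoch is independent of the intertime that follows it, and integrating out that
intertime leaves the survival probability. -/
theorem lintegral_ageValue (hxi : 0 < xi) (hR : ∀ m, HasLaw (R m) (expMeasure xi) P)
    (hind : iIndepFun R P) {f : ℝ → ENNReal} (hf : Measurable f) (t : ℝ) (m : ℕ) :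
    ∫⁻ ω, ageValue f t (epoch (fun m => R m ω) m, R m ω) ∂P
      = ∫⁻ ω, (Set.Iic t).indicator
          (fun s => ENNReal.ofReal (Real.exp (-xi * (t - s))) * f (t - s))
          (epoch (fun m => R m ω) m) ∂P := by
  have := isProbabilityMeasure_expMeasure hxi
  have : IsProbabilityMeasure P := (hR 0).isProbabilityMeasure
  have ha := fun m => (hR m).aemeasurable
  have he := aemeasurable_epoch ha m
  have h := (indepFun_iff_map_prod_eq_prod_map_map he (ha m)).1 (indepFun_epoch ha hind m)
  rw [(hR m).map_eq] at h
  have hg := measurable_ageValue hf t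
  rw [← lintegral_map' hg.aemeasurable (he.prodMk (ha m)), h, lintegral_prod _ hg.aemeasurable,
    ← lintegral_map' (Measurable.aemeasurable
      (Measurable.indicator (by fun_prop) measurableSet_Iic)) he]
  refine lintegral_congr fun s => ?_
  by_cases hs : s ≤ t
  · have : ∀ r, ageValue f t (s, r) = (Set.Ioi (t - s)).indicator (fun _ => f (t - s)) r := by
      intro r
      simp [ageValue, Set.indicator, hs, sub_lt_iff_lt_add']
    simp_rw [this]
    rw [lintegral_indicator_const measurableSet_Ioi, expMeasure_Ioi hxi (sub_nonneg.2 hs), mul_comm]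
    simp [hs]
  · simp [ageValue, hs]

/-- The term `m = 0` is the case of no reset. In the others the epoch densities sum to `xi`, and the
reflection `a = t - s` turns the epoch into the age. -/
theorem tsum_lintegral_ageValue (hxi : 0 < xi) (hR : ∀ m, HasLaw (R m) (expMeasure xi) P)
    (hind : iIndepFun R P) {f : ℝ → ENNReal} (hf : Measurable f) {t : ℝ} (ht : 0 ≤ t) :
    ∑' m, ∫⁻ ω, ageValue f t (epoch (fun m => R m ω) m, R m ω) ∂P
      = ENNReal.ofReal (Real.exp (-xi * t)) * f t
        + ∫⁻ a in Set.Ioo 0 t, ENNReal.ofReal (xi * Real.exp (-xi * a)) * f a := by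
  have := isProbabilityMeasure_expMeasure hxi
  have : IsProbabilityMeasure P := (hR 0).isProbabilityMeasure
  simp_rw [lintegral_ageValue hxi hR hind hf]
  rw [tsum_eq_zero_add' ENNReal.summable]
  congr 1
  · simp [epoch_zero, ht]
  · have hi : Measurable ((Set.Iic t).indicator
        (fun s => ENNReal.ofReal (Real.exp (-xi * (t - s))) * f (t - s))) :=
      Measurable.indicator (by fun_prop) measurableSet_Iic
    have h : ∀ m, ∫⁻ ω, (Set.Iic t).indicator
          (fun s => ENNReal.ofReal (Real.exp (-xi * (t - s))) * f (t - s))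
          (epoch (fun m => R m ω) (m + 1)) ∂P
        = ∫⁻ s in Set.Ioo 0 t, ENNReal.ofReal (erlangPDF xi m s) *
          (ENNReal.ofReal (Real.exp (-xi * (t - s))) * f (t - s)) := by
      intro m
      have hl := hasLaw_epoch hxi hR hind m
      rw [← lintegral_map' hi.aemeasurable hl.aemeasurable, hl.map_eq,
        lintegral_halfLineMeasure (by fun_prop), restrict_Ioo_eq_restrict_Ioc,
        ← lintegral_indicator measurableSet_Ioi, ← lintegral_indicator measurableSet_Ioc]
      congr 1; ext s
      by_cases h0 : 0 < s <;> by_cases h1 : s ≤ t <;> simp [h0, h1]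
    simp_rw [h]
    rw [← lintegral_tsum fun k => Measurable.aemeasurable (by fun_prop),
      ← setLIntegral_Ioo_reflect t fun a => ENNReal.ofReal (xi * Real.exp (-xi * a)) * f a]
    refine setLIntegral_congr_fun measurableSet_Ioo fun s hs => ?_
    rw [ENNReal.tsum_mul_right, tsum_ofReal_eq (fun k => erlangPDF_nonneg hxi hs.1.le k)
      (hasSum_erlangPDF xi s), ← mul_assoc, ENNReal.ofReal_mul hxi.le]

end Age

/-! ### The telegraph process with resets -/

section Reset

variable {Ω : Type*} [MeasurableSpace Ω] {P : Measure Ω} {lam xi : ℝ}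
  {R : ℕ → Ω → ℝ} {D : ℕ → Fin 2 → ℕ → Ω → ℝ}

/-- There are `m` resets up to time `t` and the sojourn times after the last one are in `E a`, where
`a` is the time elapsed since. -/
def resetEvent (R : ℕ → Ω → ℝ) (D : ℕ → Fin 2 → ℕ → Ω → ℝ) (j : Fin 2) (t : ℝ) (m : ℕ)
    (E : ℝ → Set ((ℕ → ℝ) × (ℕ → ℝ))) : Set Ω :=
  {ω | (epoch (fun m => R m ω) m ≤ t ∧ t < epoch (fun m => R m ω) m + R m ω) ∧
    ((fun n => D m j n ω), fun n => D m (1 - j) n ω) ∈ E (t - epoch (fun m => R m ω) m)}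

theorem hasLaw_sojourn_pair [IsProbabilityMeasure P] (hlam : 0 < lam)
    (h : IsResetTelegraphInput P lam xi R D) (j : Fin 2) (m : ℕ) :
    HasLaw (fun ω => ((fun n => D m j n ω), fun n => D m (1 - j) n ω))
      ((gcpIntertimeLaw lam).prod (gcpIntertimeLaw lam)) P := by
  have := isProbabilityMeasure_gcp hlam
  have hne : (m, j) ≠ (m, 1 - j) := by
    fin_cases j <;> simp
  have hi := h.sojourn_indep.indepFun hne
  have h1 := h.sojourn_law m j
  have h2 := h.sojourn_law m (1 - j)
  refine ⟨h1.aemeasurable.prodMk h2.aemeasurable, ?_⟩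
  have := (indepFun_iff_map_prod_eq_prod_map_map h1.aemeasurable h2.aemeasurable).1 hi
  rw [this, h1.map_eq, h2.map_eq]

theorem indepFun_age_sojourn (h : IsResetTelegraphInput P lam xi R D) (j : Fin 2) (m : ℕ) :
    IndepFun (fun ω => (epoch (fun m => R m ω) m, R m ω))
      (fun ω => ((fun n => D m j n ω), fun n => D m (1 - j) n ω)) P :=
  h.reset_indep_sojourn.comp (φ := fun r : ℕ → ℝ => (epoch r m, r m))
    (ψ := fun d : ℕ × Fin 2 → ℕ → ℝ => (d (m, j), d (m, 1 - j))) (by fun_prop) (by fun_prop)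

theorem aemeasurable_age (h : IsResetTelegraphInput P lam xi R D) (m : ℕ) :
    AEMeasurable (fun ω => (epoch (fun m => R m ω) m, R m ω)) P :=
  (aemeasurable_epoch (fun m => (h.reset_law m).aemeasurable) m).prodMk (h.reset_law m).aemeasurable

theorem measurableSet_resetEvent_aux {E : ℝ → Set ((ℕ → ℝ) × (ℕ → ℝ))}
    (hE : MeasurableSet {q : ℝ × ((ℕ → ℝ) × (ℕ → ℝ)) | q.2 ∈ E q.1}) (t : ℝ) :
    MeasurableSet {q : (ℝ × ℝ) × ((ℕ → ℝ) × (ℕ → ℝ)) |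
      (q.1.1 ≤ t ∧ t < q.1.1 + q.1.2) ∧ q.2 ∈ E (t - q.1.1)} :=
  MeasurableSet.inter (measurable_fst (measurableSet_age t))
    (measurableSet_preimage (f := fun q : (ℝ × ℝ) × ((ℕ → ℝ) × (ℕ → ℝ)) => (t - q.1.1, q.2))
      (by fun_prop) hE)

theorem nullMeasurableSet_resetEvent [IsProbabilityMeasure P] (hlam : 0 < lam)
    (h : IsResetTelegraphInput P lam xi R D) (j : Fin 2) (t : ℝ) (m : ℕ)
    {E : ℝ → Set ((ℕ → ℝ) × (ℕ → ℝ))}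
    (hE : MeasurableSet {q : ℝ × ((ℕ → ℝ) × (ℕ → ℝ)) | q.2 ∈ E q.1}) :
    NullMeasurableSet (resetEvent R D j t m E) P :=
  ((aemeasurable_age h m).prodMk
    (hasLaw_sojourn_pair hlam h j m).aemeasurable).nullMeasurableSet_preimage
      (measurableSet_resetEvent_aux hE t)

/-- Fixing the number `m` of resets makes the index of the sojourns deterministic, so independence
of resets and sojourns applies directly. -/
theorem measure_resetEvent [IsProbabilityMeasure P] (hlam : 0 < lam)
    (h : IsResetTelegraphInput P lam xi R D) (j : Fin 2) (t : ℝ) (m : ℕ)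
    {E : ℝ → Set ((ℕ → ℝ) × (ℕ → ℝ))}
    (hE : MeasurableSet {q : ℝ × ((ℕ → ℝ) × (ℕ → ℝ)) | q.2 ∈ E q.1}) :
    P (resetEvent R D j t m E) = ∫⁻ ω, ageValue
      (fun a => ((gcpIntertimeLaw lam).prod (gcpIntertimeLaw lam)) (E a)) t
      (epoch (fun m => R m ω) m, R m ω) ∂P := by
  have := isProbabilityMeasure_gcp hlam
  have hz := hasLaw_sojourn_pair hlam h j m
  have hw := aemeasurable_age h m
  have hp := (indepFun_iff_map_prod_eq_prod_map_map hw hz.aemeasurable).1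
    (indepFun_age_sojourn h j m)
  rw [hz.map_eq] at hp
  have hS := measurableSet_resetEvent_aux hE t
  have h1 : P (resetEvent R D j t m E) = (P.map fun ω => ((epoch (fun m => R m ω) m, R m ω),
      ((fun n => D m j n ω), fun n => D m (1 - j) n ω))) {q : (ℝ × ℝ) × ((ℕ → ℝ) × (ℕ → ℝ)) |
      (q.1.1 ≤ t ∧ t < q.1.1 + q.1.2) ∧ q.2 ∈ E (t - q.1.1)} := by
    rw [Measure.map_apply_of_aemeasurable (hw.prodMk hz.aemeasurable) hS]
    rfl
  rw [h1, hp, Measure.prod_apply hS, ← lintegral_map' _ hw]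
  · refine lintegral_congr fun w => ?_
    by_cases hc : w.1 ≤ t ∧ t < w.1 + w.2 <;>
      simp [ageValue, hc, Set.preimage]
  · exact (measurable_ageValue (measurable_measure_prodMk_left hE) t).aemeasurable

end Reset

/-! ### Position, velocity and number of turns on each event. -/

section ResetPaths

variable {Ω : Type*} {R : ℕ → Ω → ℝ} {D : ℕ → Fin 2 → ℕ → Ω → ℝ}

theorem resetEvent_mono {j : Fin 2} {t : ℝ} {m : ℕ} {E E' : ℝ → Set ((ℕ → ℝ) × (ℕ → ℝ))}
    (h : ∀ a, E a ⊆ E' a) : resetEvent R D j t m E ⊆ resetEvent R D j t m E' :=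
  fun _ hω => ⟨hω.1, h _ hω.2⟩

theorem evenEvent_subset_univ (a b : ℝ) (B : Set ℝ) (k : ℕ) (t : ℝ) :
    evenEvent a b B k t ⊆ evenEvent a b Set.univ k t :=
  fun _ hp => ⟨hp.1, Set.mem_univ _⟩

theorem oddEvent_subset_univ (a b : ℝ) (B : Set ℝ) (k : ℕ) (t : ℝ) :
    oddEvent a b B k t ⊆ oddEvent a b Set.univ k t :=
  fun _ hp => ⟨hp.1, Set.mem_univ _⟩

theorem countUpTo_of_mem_resetEvent {ω : Ω} (hR : ∀ m, 0 < R m ω) {j : Fin 2} {t : ℝ} {m : ℕ}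
    {E : ℝ → Set ((ℕ → ℝ) × (ℕ → ℝ))} (h : ω ∈ resetEvent R D j t m E) :
    countUpTo (fun m => R m ω) t = m :=
  countUpTo_eq hR h.1.1 (by rw [epoch_succ]; exact h.1.2)

theorem epoch_alternating_of_mem_evenEvent {d : Fin 2 → ℕ → ℝ} {j : Fin 2} {a b t : ℝ}
    {B : Set ℝ} {k : ℕ} (h : (d j, d (1 - j)) ∈ evenEvent a b B k t) :
    epoch (alternating j d) (2 * k) ≤ t ∧ t < epoch (alternating j d) (2 * k + 1) := by
  rw [epoch_alternating_even, epoch_alternating_odd]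
  obtain ⟨⟨h1, h2⟩, -⟩ := h
  dsimp only at h1 h2
  constructor <;> linarith

theorem epoch_alternating_of_mem_oddEvent {d : Fin 2 → ℕ → ℝ} {j : Fin 2} {a b t : ℝ}
    {B : Set ℝ} {k : ℕ} (h : (d j, d (1 - j)) ∈ oddEvent a b B k t) :
    epoch (alternating j d) (2 * k + 1) ≤ t ∧ t < epoch (alternating j d) (2 * k + 1 + 1) := by
  rw [epoch_alternating_odd, show 2 * k + 1 + 1 = 2 * (k + 1) by ring, epoch_alternating_even]
  obtain ⟨⟨h1, h2⟩, -⟩ := h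
  dsimp only at h1 h2
  constructor <;> linarith

/-- The number of changes of velocity between the last reset and time `t`. -/
noncomputable def resetTurns (R : ℕ → Ω → ℝ) (D : ℕ → Fin 2 → ℕ → Ω → ℝ) (j : Fin 2) (t : ℝ)
    (ω : Ω) : ℕ :=
  countUpTo (alternating j fun i n => D (countUpTo (fun m => R m ω) t) i n ω)
    (ageOfReset (fun m => R m ω) t)

/-- The number of turns serves to show that the events for different `k` are disjoint. The set `B`
is quantified after the event, so the same `m` and `k` serve every target set. -/
theorem path_of_mem_even (v : Fin 2 → ℝ) {ω : Ω} (hR : ∀ m, 0 < R m ω)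
    (hD : ∀ m i n, 0 < D m i n ω) {j : Fin 2} {t : ℝ} {m k : ℕ}
    (h : ω ∈ resetEvent R D j t m (evenEvent (v j) (v (1 - j)) Set.univ k)) :
    resetTurns R D j t ω = 2 * k ∧ resetVelocity v R D j t ω = v j ∧
      ∀ B, ω ∈ resetEvent R D j t m (evenEvent (v j) (v (1 - j)) B k) ↔
        resetPosition v R D j t ω ∈ B := by
  have hm := countUpTo_of_mem_resetEvent hR h
  obtain ⟨h1, h2⟩ := epoch_alternating_of_mem_evenEvent (d := fun i n => D m i n ω) h.2
  have hc := countUpTo_eq (alternating_pos (hD m) j) h1 h2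
  have hp := telegraphPosition_even v j (hD m) h1 h2
  unfold resetTurns resetVelocity resetPosition ageOfReset
  rw [hm]
  refine ⟨hc, telegraphVelocity_even v j _ hc, fun B => ?_⟩
  rw [hp]
  exact ⟨fun hB => hB.2.2, fun hB => ⟨h.1, h.2.1, hB⟩⟩

theorem path_of_mem_odd (v : Fin 2 → ℝ) {ω : Ω} (hR : ∀ m, 0 < R m ω)
    (hD : ∀ m i n, 0 < D m i n ω) {j : Fin 2} {t : ℝ} {m k : ℕ}
    (h : ω ∈ resetEvent R D j t m (oddEvent (v j) (v (1 - j)) Set.univ k)) :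
    resetTurns R D j t ω = 2 * k + 1 ∧ resetVelocity v R D j t ω = v (1 - j) ∧
      ∀ B, ω ∈ resetEvent R D j t m (oddEvent (v j) (v (1 - j)) B k) ↔
        resetPosition v R D j t ω ∈ B := by
  have hm := countUpTo_of_mem_resetEvent hR h
  obtain ⟨h1, h2⟩ := epoch_alternating_of_mem_oddEvent (d := fun i n => D m i n ω) h.2
  have hc := countUpTo_eq (alternating_pos (hD m) j) h1 h2
  have hp := telegraphPosition_odd v j (hD m) h1 h2
  unfold resetTurns resetVelocity resetPosition ageOfReset
  rw [hm]
  refine ⟨hc, telegraphVelocity_odd v j _ hc, fun B => ?_⟩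
  rw [hp]
  exact ⟨fun hB => hB.2.2, fun hB => ⟨h.1, h.2.1, hB⟩⟩

end ResetPaths

/-! ### The law of the reset process as a mixture over the age. -/

section ResetLaw

variable {Ω : Type*} [MeasurableSpace Ω] {P : Measure Ω} {lam xi : ℝ}
  {R : ℕ → Ω → ℝ} {D : ℕ → Fin 2 → ℕ → Ω → ℝ}

theorem ae_input_pos (hlam : 0 < lam) (h : IsResetTelegraphInput P lam xi R D) :
    ∀ᵐ ω ∂P, (∀ m, 0 < R m ω) ∧ ∀ m i n, 0 < D m i n ω := by
  rw [Filter.eventually_and]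
  constructor
  · rw [ae_all_iff]
    intro m
    exact ((h.reset_law m).ae_iff (measurableSet_Ioi (a := (0 : ℝ))).mem).2 (ae_expMeasure_pos xi)
  · simp_rw [ae_all_iff]
    intro m i n
    refine ((h.sojourn_law m i).ae_iff (p := fun d => 0 < d n) ?_).2 ?_
    · exact (measurableSet_lt measurable_const (measurable_pi_apply n)).mem
    · filter_upwards [ae_gcp_pos hlam] with d hd using hd n

/-- The union of all `resetEvent`s of a family of events indexed by the number of turns. -/
def resetUnion (R : ℕ → Ω → ℝ) (D : ℕ → Fin 2 → ℕ → Ω → ℝ) (j : Fin 2) (t : ℝ)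
    (E : ℕ → ℝ → Set ((ℕ → ℝ) × (ℕ → ℝ))) : Set Ω :=
  ⋃ p : ℕ × ℕ, resetEvent R D j t p.1 (E p.2)

variable [IsProbabilityMeasure P]

theorem nullMeasurableSet_resetUnion (hlam : 0 < lam) (h : IsResetTelegraphInput P lam xi R D)
    (j : Fin 2) (t : ℝ) {E : ℕ → ℝ → Set ((ℕ → ℝ) × (ℕ → ℝ))}
    (hE : ∀ k, MeasurableSet {q : ℝ × ((ℕ → ℝ) × (ℕ → ℝ)) | q.2 ∈ E k q.1}) :
    NullMeasurableSet (resetUnion R D j t E) P :=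
  NullMeasurableSet.iUnion fun p => nullMeasurableSet_resetEvent hlam h j t p.1 (hE p.2)

/-- Almost surely `ω` determines both indices: the number of resets gives `m`, and the number of
turns gives `k` by injectivity of `g`. Countable additivity then applies, and the sum over `k`
passes inside the age average. -/
theorem measure_resetUnion (hlam : 0 < lam) (hxi : 0 < xi)
    (h : IsResetTelegraphInput P lam xi R D)
    (j : Fin 2) {t : ℝ} (ht : 0 ≤ t) {E : ℕ → ℝ → Set ((ℕ → ℝ) × (ℕ → ℝ))}
    (hE : ∀ k, MeasurableSet {q : ℝ × ((ℕ → ℝ) × (ℕ → ℝ)) | q.2 ∈ E k q.1})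
    {g : ℕ → ℕ} (hg : Function.Injective g)
    (hturns : ∀ᵐ ω ∂P, ∀ m k, ω ∈ resetEvent R D j t m (E k) → resetTurns R D j t ω = g k)
    {Q : ℝ → ENNReal}
    (hQ : ∀ a, 0 ≤ a →
      ∑' k, ((gcpIntertimeLaw lam).prod (gcpIntertimeLaw lam)) (E k a) = Q a) :
    P (resetUnion R D j t E) = ENNReal.ofReal (Real.exp (-xi * t)) * Q t
      + ∫⁻ a in Set.Ioo 0 t, ENNReal.ofReal (xi * Real.exp (-xi * a)) * Q a := by
  have := isProbabilityMeasure_gcp hlam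
  have hf : ∀ k, Measurable fun a =>
      ((gcpIntertimeLaw lam).prod (gcpIntertimeLaw lam)) (E k a) :=
    fun k => measurable_measure_prodMk_left (hE k)
  have hmeas : ∀ m k, AEMeasurable (fun ω => ageValue
      (fun a => ((gcpIntertimeLaw lam).prod (gcpIntertimeLaw lam)) (E k a)) t
      (epoch (fun m => R m ω) m, R m ω)) P := fun m k =>
    (measurable_ageValue (hf k) t).comp_aemeasurable (aemeasurable_age h m)
  have hnull : ∀ p : ℕ × ℕ, NullMeasurableSet (resetEvent R D j t p.1 (E p.2)) P :=
    fun p => nullMeasurableSet_resetEvent hlam h j t p.1 (hE p.2)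
  rw [resetUnion, measure_iUnion₀ ?_ hnull]
  · rw [ENNReal.tsum_prod (f := fun m k => P (resetEvent R D j t m (E k)))]
    simp_rw [measure_resetEvent hlam h j t _ (hE _)]
    have h1 : ∀ m, ∑' k, ∫⁻ ω, ageValue
          (fun a => ((gcpIntertimeLaw lam).prod (gcpIntertimeLaw lam)) (E k a)) t
          (epoch (fun m => R m ω) m, R m ω) ∂P
        = ∫⁻ ω, ageValue (fun a => ∑' k,
          ((gcpIntertimeLaw lam).prod (gcpIntertimeLaw lam)) (E k a)) t
          (epoch (fun m => R m ω) m, R m ω) ∂P := by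
      intro m
      rw [← lintegral_tsum (hmeas m)]
      refine lintegral_congr fun ω => ?_
      simp only [ageValue, Set.indicator]
      split_ifs <;> simp
    simp_rw [h1]
    rw [tsum_lintegral_ageValue hxi h.reset_law h.reset_indep (Measurable.tsum hf) ht,
      hQ t ht]
    congr 1
    refine setLIntegral_congr_fun measurableSet_Ioo fun a ha => ?_
    rw [hQ a ha.1.le]
  · intro p q hpq
    have h0 : (resetEvent R D j t p.1 (E p.2) ∩ resetEvent R D j t q.1 (E q.2) : Set Ω) =ᵐ[P] (∅ : Set Ω) := by
      filter_upwards [ae_input_pos hlam h, hturns] with ω hpos ht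
      refine propext ⟨fun hω => ?_, False.elim⟩
      refine hpq (Prod.ext ?_ (hg ?_))
      · rw [← countUpTo_of_mem_resetEvent hpos.1 hω.1, ← countUpTo_of_mem_resetEvent hpos.1 hω.2]
      · rw [← ht _ _ hω.1, ← ht _ _ hω.2]
    rw [Function.onFun, AEDisjoint, measure_congr h0, measure_empty]

theorem measure_even_resetUnion (hlam : 0 < lam) (hxi : 0 < xi)
    (h : IsResetTelegraphInput P lam xi R D) (v : Fin 2 → ℝ)
    (j : Fin 2) {t : ℝ} (ht : 0 ≤ t) {B : Set ℝ} (hB : MeasurableSet B) :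
    P (resetUnion R D j t (evenEvent (v j) (v (1 - j)) B))
      = ENNReal.ofReal (Real.exp (-xi * t)) * evenMass lam (v j) (v (1 - j)) B t
      + ∫⁻ a in Set.Ioo 0 t, ENNReal.ofReal (xi * Real.exp (-xi * a)) *
        evenMass lam (v j) (v (1 - j)) B a := by
  refine measure_resetUnion hlam hxi h j ht (fun k => measurableSet_evenEvent_graph _ _ hB k)
    (g := fun k => 2 * k) (fun x y h => by dsimp only at h; omega) ?_
    fun a ha => tsum_measure_evenEvent hlam _ _ hB ha
  filter_upwards [ae_input_pos hlam h] with ω hpos m k hω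
  exact (path_of_mem_even v hpos.1 hpos.2
    (resetEvent_mono (evenEvent_subset_univ _ _ B k) hω)).1

theorem measure_odd_resetUnion (hlam : 0 < lam) (hxi : 0 < xi)
    (h : IsResetTelegraphInput P lam xi R D) (v : Fin 2 → ℝ)
    (j : Fin 2) {t : ℝ} (ht : 0 ≤ t) {B : Set ℝ} (hB : MeasurableSet B) :
    P (resetUnion R D j t (oddEvent (v j) (v (1 - j)) B))
      = ENNReal.ofReal (Real.exp (-xi * t)) * oddMass lam (v j) (v (1 - j)) B t
      + ∫⁻ a in Set.Ioo 0 t, ENNReal.ofReal (xi * Real.exp (-xi * a)) *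
        oddMass lam (v j) (v (1 - j)) B a := by
  refine measure_resetUnion hlam hxi h j ht (fun k => measurableSet_oddEvent_graph _ _ hB k)
    (g := fun k => 2 * k + 1) (fun x y h => by dsimp only at h; omega) ?_
    fun a ha => tsum_measure_oddEvent hlam _ _ hB a
  filter_upwards [ae_input_pos hlam h] with ω hpos m k hω
  exact (path_of_mem_odd v hpos.1 hpos.2
    (resetEvent_mono (oddEvent_subset_univ _ _ B k) hω)).1

/-- Measurability in `t` is inherited from sections of measurable sets through the series. -/
theorem measurable_oddMass (hlam : 0 < lam) (a b : ℝ) {B : Set ℝ} (hB : MeasurableSet B) :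
    Measurable (oddMass lam a b B) := by
  have := isProbabilityMeasure_gcp hlam
  have h : oddMass lam a b B = fun t => ∑' k,
      ((gcpIntertimeLaw lam).prod (gcpIntertimeLaw lam)) (oddEvent a b B k t) :=
    funext fun t => (tsum_measure_oddEvent hlam a b hB t).symm
  rw [h]
  exact Measurable.tsum fun k =>
    measurable_measure_prodMk_left (measurableSet_oddEvent_graph a b hB k)

theorem exp_add_integral_exp {xi t : ℝ} (hxi : 0 < xi) (ht : 0 ≤ t) :
    ENNReal.ofReal (Real.exp (-xi * t))
      + ∫⁻ a in Set.Ioo 0 t, ENNReal.ofReal (xi * Real.exp (-xi * a)) = 1 := by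
  rw [lintegral_ofReal_Ioo ht (by fun_prop) fun a _ => by positivity,
    intervalIntegral.integral_eq_sub_of_hasDerivAt (f := fun a => -Real.exp (-xi * a)),
    ← ENNReal.ofReal_add (by positivity), ← ENNReal.ofReal_one]
  · congr 1; simp
  · have : Real.exp (-xi * t) ≤ 1 := Real.exp_le_one_iff.2 (by nlinarith)
    simp at this ⊢; linarith
  · intro a _
    convert! (((hasDerivAt_id a).const_mul (-xi)).exp).neg using 1
    simp; ring
  · exact Continuous.intervalIntegrable (by fun_prop) _ _

/-- The two unions are almost surely disjoint, by parity of the number of turns, and their masses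
add up to one. -/
theorem ae_mem_resetUnion (hlam : 0 < lam) (hxi : 0 < xi)
    (h : IsResetTelegraphInput P lam xi R D) (v : Fin 2 → ℝ) (j : Fin 2) {t : ℝ} (ht : 0 ≤ t) :
    ∀ᵐ ω ∂P, ω ∈ resetUnion R D j t (evenEvent (v j) (v (1 - j)) Set.univ) ∪
      resetUnion R D j t (oddEvent (v j) (v (1 - j)) Set.univ) := by
  have n1 := nullMeasurableSet_resetUnion hlam h j t
    fun k => measurableSet_evenEvent_graph (v j) (v (1 - j)) MeasurableSet.univ k
  have n2 := nullMeasurableSet_resetUnion hlam h j t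
    fun k => measurableSet_oddEvent_graph (v j) (v (1 - j)) MeasurableSet.univ k
  refine (mem_ae_iff_prob_eq_one₀ (n1.union n2)).2 ?_
  rw [measure_union₀ n2, measure_even_resetUnion hlam hxi h v j ht MeasurableSet.univ,
    measure_odd_resetUnion hlam hxi h v j ht MeasurableSet.univ, add_add_add_comm, ← mul_add,
    evenMass_univ_add_oddMass_univ hlam _ _ ht, mul_one, ← lintegral_add_right,
    ← exp_add_integral_exp hxi ht]
  · congr 1
    refine setLIntegral_congr_fun measurableSet_Ioo fun a ha => ?_
    rw [← mul_add, evenMass_univ_add_oddMass_univ hlam _ _ ha.1.le, mul_one]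
  · have := measurable_oddMass hlam (v j) (v (1 - j)) MeasurableSet.univ
    fun_prop
  · have h0 : (resetUnion R D j t (evenEvent (v j) (v (1 - j)) Set.univ) ∩
        resetUnion R D j t (oddEvent (v j) (v (1 - j)) Set.univ) : Set Ω) =ᵐ[P] (∅ : Set Ω) := by
      filter_upwards [ae_input_pos hlam h] with ω hpos
      refine propext ⟨fun hω => ?_, False.elim⟩
      obtain ⟨p, hp⟩ := Set.mem_iUnion.1 hω.1
      obtain ⟨q, hq⟩ := Set.mem_iUnion.1 hω.2
      have e1 := (path_of_mem_even v hpos.1 hpos.2 hp).1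
      have e2 := (path_of_mem_odd v hpos.1 hpos.2 hq).1
      omega
    rw [AEDisjoint, measure_congr h0, measure_empty]

theorem ae_position_velocity (hlam : 0 < lam) (hxi : 0 < xi)
    (h : IsResetTelegraphInput P lam xi R D) {v : Fin 2 → ℝ} (hv : v 0 ≠ v 1) (j : Fin 2) {t : ℝ}
    (ht : 0 ≤ t) (B : Set ℝ) :
    ∀ᵐ ω ∂P, (resetVelocity v R D j t ω = v j ∨ resetVelocity v R D j t ω = v (1 - j)) ∧
      ((resetPosition v R D j t ω ∈ B ∧ resetVelocity v R D j t ω = v j) ↔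
        ω ∈ resetUnion R D j t (evenEvent (v j) (v (1 - j)) B)) ∧
      ((resetPosition v R D j t ω ∈ B ∧ resetVelocity v R D j t ω = v (1 - j)) ↔
        ω ∈ resetUnion R D j t (oddEvent (v j) (v (1 - j)) B)) := by
  have hne : v j ≠ v (1 - j) := by
    fin_cases j
    · exact hv
    · exact hv.symm
  filter_upwards [ae_input_pos hlam h, ae_mem_resetUnion hlam hxi h v j ht] with ω hpos hω
  have he : ∀ m k, ω ∈ resetEvent R D j t m (evenEvent (v j) (v (1 - j)) B k) →
      ω ∈ resetEvent R D j t m (evenEvent (v j) (v (1 - j)) Set.univ k) := fun m k hm =>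
    resetEvent_mono (evenEvent_subset_univ _ _ B k) hm
  have ho : ∀ m k, ω ∈ resetEvent R D j t m (oddEvent (v j) (v (1 - j)) B k) →
      ω ∈ resetEvent R D j t m (oddEvent (v j) (v (1 - j)) Set.univ k) := fun m k hm =>
    resetEvent_mono (oddEvent_subset_univ _ _ B k) hm
  have he' : ω ∈ resetUnion R D j t (evenEvent (v j) (v (1 - j)) B) →
      resetPosition v R D j t ω ∈ B ∧ resetVelocity v R D j t ω = v j := by
    intro hm
    obtain ⟨p, hp⟩ := Set.mem_iUnion.1 hm
    obtain ⟨-, e2, e3⟩ := path_of_mem_even v hpos.1 hpos.2 (he _ _ hp)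
    exact ⟨(e3 B).1 hp, e2⟩
  have ho' : ω ∈ resetUnion R D j t (oddEvent (v j) (v (1 - j)) B) →
      resetPosition v R D j t ω ∈ B ∧ resetVelocity v R D j t ω = v (1 - j) := by
    intro hm
    obtain ⟨p, hp⟩ := Set.mem_iUnion.1 hm
    obtain ⟨-, e2, e3⟩ := path_of_mem_odd v hpos.1 hpos.2 (ho _ _ hp)
    exact ⟨(e3 B).1 hp, e2⟩
  rcases hω with hω | hω
  · obtain ⟨p, hp⟩ := Set.mem_iUnion.1 hω
    obtain ⟨-, e2, e3⟩ := path_of_mem_even v hpos.1 hpos.2 hp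
    exact ⟨Or.inl e2, ⟨fun hB => Set.mem_iUnion.2 ⟨p, (e3 B).2 hB.1⟩, he'⟩,
      ⟨fun hB => absurd (e2.symm.trans hB.2) hne, ho'⟩⟩
  · obtain ⟨p, hp⟩ := Set.mem_iUnion.1 hω
    obtain ⟨-, e2, e3⟩ := path_of_mem_odd v hpos.1 hpos.2 hp
    exact ⟨Or.inr e2, ⟨fun hB => absurd (hB.2.symm.trans e2) hne, he'⟩,
      ⟨fun hB => Set.mem_iUnion.2 ⟨p, (e3 B).2 hB.1⟩, ho'⟩⟩

theorem measure_position_sameVelocity (hlam : 0 < lam) (hxi : 0 < xi)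
    (h : IsResetTelegraphInput P lam xi R D) {v : Fin 2 → ℝ} (hv : v 0 ≠ v 1) (j : Fin 2) {t : ℝ}
    (ht : 0 ≤ t) {B : Set ℝ} (hB : MeasurableSet B) :
    P {ω | resetPosition v R D j t ω ∈ B ∧ resetVelocity v R D j t ω = v j}
      = ENNReal.ofReal (Real.exp (-xi * t)) * evenMass lam (v j) (v (1 - j)) B t
      + ∫⁻ a in Set.Ioo 0 t, ENNReal.ofReal (xi * Real.exp (-xi * a)) *
        evenMass lam (v j) (v (1 - j)) B a := by
  rw [← measure_even_resetUnion hlam hxi h v j ht hB]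
  refine measure_congr ?_
  filter_upwards [ae_position_velocity hlam hxi h hv j ht B] with ω hω using propext hω.2.1

theorem measure_position_otherVelocity (hlam : 0 < lam) (hxi : 0 < xi)
    (h : IsResetTelegraphInput P lam xi R D) {v : Fin 2 → ℝ} (hv : v 0 ≠ v 1) (j : Fin 2) {t : ℝ}
    (ht : 0 ≤ t) {B : Set ℝ} (hB : MeasurableSet B) :
    P {ω | resetPosition v R D j t ω ∈ B ∧ resetVelocity v R D j t ω = v (1 - j)}
      = ENNReal.ofReal (Real.exp (-xi * t)) * oddMass lam (v j) (v (1 - j)) B t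
      + ∫⁻ a in Set.Ioo 0 t, ENNReal.ofReal (xi * Real.exp (-xi * a)) *
        oddMass lam (v j) (v (1 - j)) B a := by
  rw [← measure_odd_resetUnion hlam hxi h v j ht hB]
  refine measure_congr ?_
  filter_upwards [ae_position_velocity hlam hxi h hv j ht B] with ω hω using propext hω.2.2

theorem positionLaw_eq_add (hlam : 0 < lam) (hxi : 0 < xi)
    (h : IsResetTelegraphInput P lam xi R D) {v : Fin 2 → ℝ} (hv : v 0 ≠ v 1) (j : Fin 2) {t : ℝ}
    (ht : 0 ≤ t) {B : Set ℝ} (hB : MeasurableSet B) :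
    positionLaw P v R D j t B
      = positionSubLaw P v R D j j t B + positionSubLaw P v R D j (1 - j) t B := by
  have hae := ae_position_velocity hlam hxi h hv j ht B
  have hne : v j ≠ v (1 - j) := by
    fin_cases j
    · exact hv
    · exact hv.symm
  -- Position and velocity are not shown to be measurable; the event agrees almost surely with a
  -- null measurable union.
  have n2 : NullMeasurableSet
      {ω | resetPosition v R D j t ω ∈ B ∧ resetVelocity v R D j t ω = v (1 - j)} P := by
    refine (nullMeasurableSet_resetUnion hlam h j t
      fun k => measurableSet_oddEvent_graph (v j) (v (1 - j)) hB k).congr ?_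
    filter_upwards [hae] with ω hω using propext hω.2.2.symm
  unfold positionLaw positionSubLaw
  rw [← measureReal_union₀ n2]
  · refine measureReal_congr ?_
    filter_upwards [hae] with ω hω
    refine propext ⟨fun hB => ?_, fun hB => hB.elim And.left And.left⟩
    exact hω.1.imp (fun h => ⟨hB, h⟩) fun h => ⟨hB, h⟩
  · refine Disjoint.aedisjoint (Set.disjoint_left.2 ?_)
    exact fun ω h1 h2 => hne (h1.2.symm.trans h2.2)

end ResetLaw

/-! ### Densities in the space variable -/

theorem ind_of {A : Prop} (h : A) : ind A = 1 := if_pos h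

theorem ind_of_not {A : Prop} (h : ¬ A) : ind A = 0 := if_neg h

theorem measurable_ind {α : Type*} [MeasurableSpace α] {p : α → Prop}
    (hp : MeasurableSet {x | p x}) : Measurable fun x => ind (p x) := by
  classical
  have : (fun x => ind (p x)) = {x | p x}.indicator 1 := by
    ext x
    by_cases h : p x
    · rw [ind_of h]; simp [h]
    · rw [ind_of_not h]; simp [h]
  rw [this]
  exact measurable_one.indicator hp

theorem setLIntegral_mul_indicator_one {B : Set ℝ} (hB : MeasurableSet B) (S : Set ℝ)
    (F : ℝ → ENNReal) :
    ∫⁻ x in S, F x * B.indicator 1 x = ∫⁻ x in B ∩ S, F x := by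
  have : ∀ x, F x * B.indicator 1 x = B.indicator F x := fun x => by
    by_cases h : x ∈ B <;> simp [h]
  simp_rw [this]
  rw [lintegral_indicator hB, Measure.restrict_restrict hB]

/-- Change of variables along an affine map that sends `S` onto `T`. -/
theorem setLIntegral_affine {p q : ℝ} (hp : p ≠ 0) {S T B : Set ℝ} (hS : MeasurableSet S)
    (hT : MeasurableSet T)
    (hST : ∀ x, x ∈ T ↔ (x - q) / p ∈ S) (hB : MeasurableSet B) (F : ℝ → ENNReal) :
    ∫⁻ u in S, F u * B.indicator 1 (p * u + q)
      = ∫⁻ x in B, T.indicator (fun x => ENNReal.ofReal |p|⁻¹ * F ((x - q) / p)) x := by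
  have h := lintegral_image_eq_lintegral_abs_deriv_mul (s := S) (f := fun u => p * u + q)
    (f' := fun _ => p) hS
    (fun x _ => by simpa using (((hasDerivAt_id x).const_mul p).add_const q).hasDerivWithinAt)
    (fun x _ y _ h => mul_left_cancel₀ hp (add_right_cancel h))
    -- The factor `|p|⁻¹` is built in to cancel the Jacobian.
    (fun x => ENNReal.ofReal |p|⁻¹ * F ((x - q) / p) * B.indicator 1 x)
  have hI : (fun u => p * u + q) '' S = T := by
    ext x
    rw [hST]
    constructor
    · rintro ⟨u, hu, rfl⟩
      simpa [hp] using hu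
    · exact fun hx => ⟨_, hx, by field_simp; ring⟩
  rw [hI] at h
  rw [lintegral_indicator hT, Measure.restrict_restrict hT, Set.inter_comm T B,
    ← setLIntegral_mul_indicator_one hB, h]
  refine lintegral_congr fun u => ?_
  have hpp : 0 < |p| := abs_pos.2 hp
  have h1 : ENNReal.ofReal |p| * ENNReal.ofReal |p|⁻¹ = 1 := by
    rw [← ENNReal.ofReal_mul hpp.le, mul_inv_cancel₀ hpp.ne', ENNReal.ofReal_one]
  rw [← mul_assoc, ← mul_assoc, h1, one_mul, add_sub_cancel_right, mul_div_cancel_left₀ _ hp]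

theorem other_ne {v : Fin 2 → ℝ} (hv : v 1 < v 0) (j : Fin 2) : v j - v (1 - j) ≠ 0 := by
  fin_cases j
  · exact sub_ne_zero.2 hv.ne'
  · exact sub_ne_zero.2 hv.ne

theorem abs_velocity_sub {v : Fin 2 → ℝ} (hv : v 1 < v 0) (j : Fin 2) :
    |v j - v (1 - j)| = v 0 - v 1 := by
  fin_cases j
  · exact abs_of_pos (sub_pos.2 hv)
  · simpa using abs_sub_comm (v 1) (v 0) |>.trans (abs_of_pos (sub_pos.2 hv))

/-- The time that the particle at `x` at time `t` has spent with the velocity number `j`. -/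
noncomputable def timeIn (v : Fin 2 → ℝ) (j : Fin 2) (x t : ℝ) : ℝ :=
  (x - v (1 - j) * t) / (v j - v (1 - j))

theorem timeIn_add {v : Fin 2 → ℝ} (hv : v 1 < v 0) (j : Fin 2) (x t : ℝ) :
    timeIn v j x t + timeIn v (1 - j) x t = t := by
  have h := other_ne hv j
  have h' : v (1 - j) - v j ≠ 0 := by rwa [← neg_sub, neg_ne_zero]
  unfold timeIn
  rw [sub_sub_cancel, show v (1 - j) - v j = -(v j - v (1 - j)) by ring, div_neg]
  field_simp
  ring

theorem mem_region_iff {v : Fin 2 → ℝ} (hv : v 1 < v 0) (j : Fin 2) (x t : ℝ) :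
    x ∈ Set.Ioo (v 1 * t) (v 0 * t) ↔ timeIn v j x t ∈ Set.Ioo 0 t := by
  have h0 : x ∈ Set.Ioo (v 1 * t) (v 0 * t) ↔ timeIn v 0 x t ∈ Set.Ioo 0 t := by
    have hd : 0 < v 0 - v 1 := sub_pos.2 hv
    simp only [timeIn, Set.mem_Ioo, sub_zero, lt_div_iff₀ hd, div_lt_iff₀ hd, zero_mul]
    constructor <;> rintro ⟨h1, h2⟩ <;> constructor <;> nlinarith
  fin_cases j
  · exact h0
  · have h1 := timeIn_add hv 0 x t
    rw [h0]
    simp only [Set.mem_Ioo, sub_zero] at h1 ⊢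
    constructor <;> rintro ⟨h2, h3⟩ <;> constructor <;> simp at * <;> linarith

/-- The density of the position at time `t`, on the event that the velocity at time `t` is the
initial velocity. -/
noncomputable def sameDensity (v : Fin 2 → ℝ) (lam : ℝ) (j : Fin 2) (x t : ℝ) : ℝ :=
  lam ^ 2 * timeIn v j x t / (1 + lam * t) ^ 2 / (v 0 - v 1)

/-- The density of the position at time `t`, on the event that the velocity at time `t` is not the
initial velocity. -/
noncomputable def otherDensity (v : Fin 2 → ℝ) (lam : ℝ) (j : Fin 2) (x t : ℝ) : ℝ :=
  lam * (1 + lam * (t - timeIn v j x t)) / (1 + lam * t) ^ 2 / (v 0 - v 1)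

/-- The density `h`, restricted to the region that the particle can reach. -/
noncomputable def reachable (v : Fin 2 → ℝ) (h : ℝ → ℝ → ℝ) (x t : ℝ) : ENNReal :=
  ENNReal.ofReal (ind (v 1 * t < x ∧ x < v 0 * t) * h x t)

/-- The substitution is `x = v_j u + v_{1-j} (t - u)`, with inverse `timeIn` and Jacobian `v 0 - v
1` for either `j`. -/
theorem setLIntegral_mixture {v : Fin 2 → ℝ} (hv : v 1 < v 0) (j : Fin 2) (t : ℝ) {f : ℝ → ℝ}
    {B : Set ℝ} (hB : MeasurableSet B) :
    ∫⁻ u in Set.Ioo 0 t, ENNReal.ofReal (f u) *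
        B.indicator 1 (v j * u + v (1 - j) * (t - u))
      = ∫⁻ x in B, reachable v (fun x t => f (timeIn v j x t) / (v 0 - v 1)) x t := by
  have h := setLIntegral_affine (q := v (1 - j) * t) (other_ne hv j) measurableSet_Ioo
    measurableSet_Ioo (fun x => mem_region_iff hv j x t) hB fun u => ENNReal.ofReal (f u)
  rw [show (fun u => ENNReal.ofReal (f u) * B.indicator 1 (v j * u + v (1 - j) * (t - u)))
    = fun u => ENNReal.ofReal (f u) *
      B.indicator 1 ((v j - v (1 - j)) * u + v (1 - j) * t) from by
    ext u; congr 2; ring]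
  rw [h]
  refine lintegral_congr fun x => ?_
  rw [abs_velocity_sub hv, reachable]
  have hd : 0 < v 0 - v 1 := sub_pos.2 hv
  by_cases hx : v 1 * t < x ∧ x < v 0 * t
  · rw [Set.indicator_of_mem (Set.mem_Ioo.2 hx), ind_of hx, one_mul,
      ← ENNReal.ofReal_mul (by positivity)]
    congr 1
    rw [inv_mul_eq_div, timeIn]
  · rw [Set.indicator_of_notMem (by simpa using hx), ind_of_not hx]
    simp

theorem evenMass_eq {v : Fin 2 → ℝ} (hv : v 1 < v 0) (lam : ℝ) (j : Fin 2) (t : ℝ)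
    {B : Set ℝ} (hB : MeasurableSet B) :
    evenMass lam (v j) (v (1 - j)) B t
      = ENNReal.ofReal (1 / (1 + lam * t)) * B.indicator 1 (v j * t)
        + ∫⁻ x in B, reachable v (sameDensity v lam j) x t := by
  have h := setLIntegral_mixture hv j t (f := fun u => lam ^ 2 * u / (1 + lam * t) ^ 2) hB
  -- `evenMass` integrates over the time spent with the other velocity; reflection passes to the
  -- time spent with the initial one.
  rw [evenMass, ← setLIntegral_Ioo_reflect t]
  simp only [sub_sub_cancel]
  rw [h]
  rfl

theorem oddMass_eq {v : Fin 2 → ℝ} (hv : v 1 < v 0) (lam : ℝ) (j : Fin 2) (t : ℝ)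
    {B : Set ℝ} (hB : MeasurableSet B) :
    oddMass lam (v j) (v (1 - j)) B t
      = ∫⁻ x in B, reachable v (otherDensity v lam j) x t :=
  setLIntegral_mixture hv j t (f := fun u => lam * (1 + lam * (t - u)) / (1 + lam * t) ^ 2) hB

/-! ### Mixing over the age -/

/-- The earliest age at which the particle can be at `x`. -/
noncomputable def lowerAge (v : Fin 2 → ℝ) (x : ℝ) : ℝ := if v 1 < 0 then bigM v x else x / v 0

/-- The latest age up to `t` at which the particle can be at `x`. -/
noncomputable def upperAge (v : Fin 2 → ℝ) (x t : ℝ) : ℝ := if v 1 < 0 then t else smallM v x t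

/-- At fixed `x` the conditions on the age cut out an interval, whose endpoints depend on the sign
of `v 1`: dividing by `v 1` gives a lower bound when it is negative and an upper bound when it is
positive. The condition in `boldI` is kept separate because without it the endpoints are reversed,
and an interval integral would change sign instead of vanishing. -/
theorem reachable_age_iff {v : Fin 2 → ℝ}
    (hv : (v 1 < 0 ∧ 0 < v 0) ∨ (0 < v 1 ∧ v 1 < v 0)) {x t : ℝ} (ht : 0 < t) (a : ℝ) :
    (0 < a ∧ a < t) ∧ (v 1 * a < x ∧ x < v 0 * a) ↔
      (min (v 1 * t) 0 < x ∧ x < v 0 * t) ∧ (lowerAge v x < a ∧ a < upperAge v x t) := by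
  rcases hv with ⟨h1, h0⟩ | ⟨h1, h01⟩
  · have hm : min (v 1 * t) 0 = v 1 * t := min_eq_left (by nlinarith)
    rw [lowerAge, upperAge, if_pos h1, if_pos h1, bigM, hm, max_lt_iff, div_lt_iff₀ h0,
      div_lt_iff_of_neg h1]
    constructor
    · rintro ⟨⟨h2, h3⟩, h4, h5⟩
      refine ⟨⟨by nlinarith, by nlinarith⟩, ⟨by linarith, by linarith⟩, h3⟩
    · rintro ⟨⟨h2, h3⟩, ⟨h4, h5⟩, h6⟩
      refine ⟨⟨?_, h6⟩, by linarith, by linarith⟩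
      by_contra! ha
      nlinarith
  · have h0 : 0 < v 0 := h1.trans h01
    have hm : min (v 1 * t) 0 = 0 := min_eq_right (by positivity)
    rw [lowerAge, upperAge, if_neg h1.not_gt, if_neg h1.not_gt, smallM, hm, lt_min_iff,
      div_lt_iff₀ h0, lt_div_iff₀ h1]
    constructor
    · rintro ⟨⟨h2, h3⟩, h4, h5⟩
      refine ⟨⟨by nlinarith, by nlinarith⟩, by linarith, by linarith, h3⟩
    · rintro ⟨⟨h2, h3⟩, h4, h5, h6⟩
      refine ⟨⟨?_, h6⟩, by linarith, by linarith⟩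
      by_contra! ha
      nlinarith

theorem lowerAge_bounds {v : Fin 2 → ℝ}
    (hv : (v 1 < 0 ∧ 0 < v 0) ∨ (0 < v 1 ∧ v 1 < v 0)) {x t : ℝ} (ht : 0 < t)
    (hx : min (v 1 * t) 0 < x ∧ x < v 0 * t) :
    0 ≤ lowerAge v x ∧ lowerAge v x ≤ upperAge v x t := by
  rcases hv with ⟨h1, h0⟩ | ⟨h1, h01⟩
  · have hm : min (v 1 * t) 0 = v 1 * t := min_eq_left (by nlinarith)
    rw [hm] at hx
    rw [lowerAge, upperAge, if_pos h1, if_pos h1, bigM, le_max_iff]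
    constructor
    · rcases le_total 0 x with h | h
      · exact Or.inl (div_nonneg h h0.le)
      · exact Or.inr (div_nonneg_of_nonpos h h1.le)
    · rw [max_le_iff, div_le_iff₀ h0, div_le_iff_of_neg h1]
      constructor <;> linarith
  · have h0 : 0 < v 0 := h1.trans h01
    have hm : min (v 1 * t) 0 = 0 := min_eq_right (by positivity)
    rw [hm] at hx
    rw [lowerAge, upperAge, if_neg h1.not_gt, if_neg h1.not_gt, smallM, le_min_iff]
    refine ⟨div_nonneg hx.1.le h0.le, ?_, ?_⟩
    · exact div_le_div_of_nonneg_left hx.1.le h1 h01.le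
    · rw [div_le_iff₀ h0]; linarith

/-- The density `h`, mixed over the age of the motion at time `t`. -/
noncomputable def mixedDensity (v : Fin 2 → ℝ) (xi : ℝ) (h : ℝ → ℝ → ℝ) (t x : ℝ) : ℝ :=
  Real.exp (-xi * t) * (ind (v 1 * t < x ∧ x < v 0 * t) * h x t)
    + boldI v x t * ∫ a in (lowerAge v x)..(upperAge v x t), xi * Real.exp (-xi * a) * h x a

/-- A family of densities that can be mixed. -/
structure IsDensityFamily (v : Fin 2 → ℝ) (h : ℝ → ℝ → ℝ) : Prop where
  measurable : Measurable fun p : ℝ × ℝ => h p.1 p.2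
  continuousOn : ∀ x, ContinuousOn (h x) (Set.Ici 0)
  nonneg : ∀ x t, 0 ≤ t → v 1 * t < x → x < v 0 * t → 0 ≤ h x t

theorem measurable_timeIn (v : Fin 2 → ℝ) (j : Fin 2) :
    Measurable fun p : ℝ × ℝ => timeIn v j p.1 p.2 := by
  unfold timeIn; fun_prop

theorem isDensityFamily_same {v : Fin 2 → ℝ} (hv : v 1 < v 0) {lam : ℝ} (hlam : 0 < lam)
    (j : Fin 2) : IsDensityFamily v (sameDensity v lam j) where
  measurable := by
    have := measurable_timeIn v j
    unfold sameDensity; fun_prop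
  continuousOn x := by
    unfold sameDensity timeIn
    refine ContinuousOn.div_const (ContinuousOn.div (by fun_prop) (by fun_prop) fun t ht => ?_) _
    have : 0 ≤ t := ht
    positivity
  nonneg x t ht h1 h2 := by
    have hU := ((mem_region_iff hv j x t).1 ⟨h1, h2⟩).1
    have hd : 0 < v 0 - v 1 := sub_pos.2 hv
    unfold sameDensity; positivity

theorem isDensityFamily_other {v : Fin 2 → ℝ} (hv : v 1 < v 0) {lam : ℝ} (hlam : 0 < lam)
    (j : Fin 2) : IsDensityFamily v (otherDensity v lam j) where
  measurable := by
    have := measurable_timeIn v j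
    unfold otherDensity; fun_prop
  continuousOn x := by
    unfold otherDensity timeIn
    refine ContinuousOn.div_const (ContinuousOn.div (by fun_prop) (by fun_prop) fun t ht => ?_) _
    have : 0 ≤ t := ht
    positivity
  nonneg x t ht h1 h2 := by
    have hU := sub_pos.2 ((mem_region_iff hv j x t).1 ⟨h1, h2⟩).2
    have hd : 0 < v 0 - v 1 := sub_pos.2 hv
    unfold otherDensity; positivity

section Mixed

variable {v : Fin 2 → ℝ} {xi : ℝ} {h : ℝ → ℝ → ℝ}

theorem IsDensityFamily.measurable_reachable (hh : IsDensityFamily v h) :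
    Measurable fun p : ℝ × ℝ => reachable v h p.1 p.2 := by
  have h1 := measurable_ind (p := fun p : ℝ × ℝ => v 1 * p.2 < p.1 ∧ p.1 < v 0 * p.2)
    (MeasurableSet.inter
      (measurableSet_lt (f := fun p : ℝ × ℝ => v 1 * p.2) (by fun_prop) measurable_fst)
      (measurableSet_lt (g := fun p : ℝ × ℝ => v 0 * p.2) measurable_fst (by fun_prop)))
  have h2 := hh.measurable
  unfold reachable
  fun_prop

/-- Nonnegativity is part of the conclusion because `ENNReal.ofReal` would hide a negative value. -/
theorem lintegral_reachable (hv : (v 1 < 0 ∧ 0 < v 0) ∨ (0 < v 1 ∧ v 1 < v 0)) (hxi : 0 < xi)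
    (hh : IsDensityFamily v h) {t : ℝ} (ht : 0 < t) (x : ℝ) :
    0 ≤ boldI v x t * ∫ a in (lowerAge v x)..(upperAge v x t), xi * Real.exp (-xi * a) * h x a ∧
    ∫⁻ a in Set.Ioo 0 t, ENNReal.ofReal (xi * Real.exp (-xi * a)) * reachable v h x a
      = ENNReal.ofReal (boldI v x t *
        ∫ a in (lowerAge v x)..(upperAge v x t), xi * Real.exp (-xi * a) * h x a) := by
  by_cases hx : min (v 1 * t) 0 < x ∧ x < v 0 * t
  · obtain ⟨hl, hlu⟩ := lowerAge_bounds hv ht hx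
    have hn : ∀ a ∈ Set.Ioo (lowerAge v x) (upperAge v x t),
        0 ≤ xi * Real.exp (-xi * a) * h x a := by
      intro a ha
      obtain ⟨⟨h1, h2⟩, h3, h4⟩ := (reachable_age_iff hv ht a).2 ⟨hx, ha⟩
      have := hh.nonneg x a h1.le h3 h4
      positivity
    rw [boldI, ind_of hx, one_mul]
    constructor
    · rw [intervalIntegral.integral_of_le hlu, integral_Ioc_eq_integral_Ioo]
      exact setIntegral_nonneg measurableSet_Ioo hn
    · have hc : ContinuousOn (fun a => xi * Real.exp (-xi * a) * h x a)
          (Set.Icc (lowerAge v x) (upperAge v x t)) := by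
        refine ContinuousOn.mul (by fun_prop) ((hh.continuousOn x).mono fun a ha => ?_)
        exact hl.trans ha.1
      rw [← lintegral_ofReal_Ioo hlu hc hn, ← lintegral_indicator measurableSet_Ioo,
        ← lintegral_indicator measurableSet_Ioo]
      refine lintegral_congr fun a => ?_
      have hiff := reachable_age_iff hv (x := x) ht a
      by_cases ha : (0 < a ∧ a < t) ∧ (v 1 * a < x ∧ x < v 0 * a)
      · rw [Set.indicator_of_mem (Set.mem_Ioo.2 ha.1),
          Set.indicator_of_mem (Set.mem_Ioo.2 (hiff.1 ha).2), reachable, ind_of ha.2, one_mul,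
          ← ENNReal.ofReal_mul (by positivity)]
      · have ha' : a ∉ Set.Ioo (lowerAge v x) (upperAge v x t) := fun h => ha (hiff.2 ⟨hx, h⟩)
        rw [Set.indicator_of_notMem ha']
        by_cases h0 : a ∈ Set.Ioo 0 t
        · rw [Set.indicator_of_mem h0, reachable, ind_of_not fun h => ha ⟨h0, h⟩]
          simp
        · rw [Set.indicator_of_notMem h0]
  · rw [boldI, ind_of_not hx, zero_mul]
    refine ⟨le_rfl, ?_⟩
    rw [ENNReal.ofReal_zero]
    rw [setLIntegral_congr_fun (g := fun _ => 0) measurableSet_Ioo fun a ha => ?_, lintegral_zero]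
    rw [reachable, ind_of_not fun h => hx ((reachable_age_iff hv ht a).1 ⟨ha, h⟩).1]
    simp

theorem mixedDensity_nonneg (hv : (v 1 < 0 ∧ 0 < v 0) ∨ (0 < v 1 ∧ v 1 < v 0)) (hxi : 0 < xi)
    (hh : IsDensityFamily v h) {t : ℝ} (ht : 0 < t) (x : ℝ) : 0 ≤ mixedDensity v xi h t x := by
  refine add_nonneg (mul_nonneg (Real.exp_nonneg _) ?_) (lintegral_reachable hv hxi hh ht x).1
  by_cases hx : v 1 * t < x ∧ x < v 0 * t
  · rw [ind_of hx, one_mul]; exact hh.nonneg x t ht.le hx.1 hx.2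
  · rw [ind_of_not hx, zero_mul]

theorem ofReal_mixedDensity (hv : (v 1 < 0 ∧ 0 < v 0) ∨ (0 < v 1 ∧ v 1 < v 0)) (hxi : 0 < xi)
    (hh : IsDensityFamily v h) {t : ℝ} (ht : 0 < t) (x : ℝ) :
    ENNReal.ofReal (mixedDensity v xi h t x)
      = ENNReal.ofReal (Real.exp (-xi * t)) * reachable v h x t
        + ∫⁻ a in Set.Ioo 0 t, ENNReal.ofReal (xi * Real.exp (-xi * a)) * reachable v h x a := by
  have hr := lintegral_reachable hv hxi hh ht x
  rw [hr.2, reachable, ← ENNReal.ofReal_mul (Real.exp_nonneg _), ← ENNReal.ofReal_add _ hr.1]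
  · rfl
  · refine mul_nonneg (Real.exp_nonneg _) ?_
    by_cases hx : v 1 * t < x ∧ x < v 0 * t
    · rw [ind_of hx, one_mul]; exact hh.nonneg x t ht.le hx.1 hx.2
    · rw [ind_of_not hx, zero_mul]

theorem measurable_mixedDensity (hv : (v 1 < 0 ∧ 0 < v 0) ∨ (0 < v 1 ∧ v 1 < v 0)) (hxi : 0 < xi)
    (hh : IsDensityFamily v h) {t : ℝ} (ht : 0 < t) : Measurable (mixedDensity v xi h t) := by
  -- Passing through `ENNReal` gives a parametric integral over the fixed set `(0, t)`, instead of
  -- one with endpoints depending on `x`.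
  have h1 : mixedDensity v xi h t = fun x => (ENNReal.ofReal (mixedDensity v xi h t x)).toReal := by
    ext x; rw [ENNReal.toReal_ofReal (mixedDensity_nonneg hv hxi hh ht x)]
  have h2 := hh.measurable_reachable
  have h3 : Measurable fun x => reachable v h x t := h2.comp measurable_prodMk_right
  have h4 : Measurable fun x => ∫⁻ a in Set.Ioo 0 t,
      ENNReal.ofReal (xi * Real.exp (-xi * a)) * reachable v h x a :=
    Measurable.lintegral_prod_right (by fun_prop)
  rw [h1]
  simp_rw [ofReal_mixedDensity hv hxi hh ht]
  fun_prop

/-- Tonelli: mixing the laws over the age is integrating the mixed density. -/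
theorem lintegral_mixedDensity (hv : (v 1 < 0 ∧ 0 < v 0) ∨ (0 < v 1 ∧ v 1 < v 0)) (hxi : 0 < xi)
    (hh : IsDensityFamily v h) {t : ℝ} (ht : 0 < t) (B : Set ℝ) :
    ENNReal.ofReal (Real.exp (-xi * t)) * (∫⁻ x in B, reachable v h x t)
      + ∫⁻ a in Set.Ioo 0 t, ENNReal.ofReal (xi * Real.exp (-xi * a)) *
        ∫⁻ x in B, reachable v h x a
      = ∫⁻ x in B, ENNReal.ofReal (mixedDensity v xi h t x) := by
  have h2 := hh.measurable_reachable
  have h3 : ∀ t, Measurable fun x => reachable v h x t := fun t => h2.comp measurable_prodMk_right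
  simp_rw [ofReal_mixedDensity hv hxi hh ht]
  rw [lintegral_add_left (by fun_prop), lintegral_const_mul _ (by fun_prop),
    lintegral_lintegral_swap (by fun_prop)]
  congr 1
  refine lintegral_congr fun a => ?_
  rw [lintegral_const_mul _ (by fun_prop)]

end Mixed

/-! ### Generalized densities -/

/-- Integrability of `f` is automatic, since its integral is bounded by the finite mass of `P`. -/
theorem hasGeneralizedDensity_of_measure {Ω : Type*} [MeasurableSpace Ω] {P : Measure Ω}
    [IsFiniteMeasure P] {S : Set ℝ → Set Ω} {c a : ℝ} {f : ℝ → ℝ} (hc : 0 ≤ c)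
    (hf : Measurable f) (h0 : ∀ x, 0 ≤ f x)
    (h : ∀ B, MeasurableSet B → P (S B) = ENNReal.ofReal c * B.indicator 1 a
      + ∫⁻ x in B, ENNReal.ofReal (f x)) :
    HasGeneralizedDensity (fun B => P.real (S B)) c a f := by
  have hfin : ∀ B, MeasurableSet B → ∫⁻ x in B, ENNReal.ofReal (f x) ≠ ⊤ := fun B hB =>
    ne_top_of_le_ne_top (measure_ne_top P (S B)) (by rw [h B hB]; exact le_add_self)
  constructor
  · refine ⟨hf.aestronglyMeasurable, ?_⟩
    rw [hasFiniteIntegral_iff_ofReal (Filter.Eventually.of_forall h0), ← setLIntegral_univ]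
    exact (hfin _ MeasurableSet.univ).lt_top
  · intro B hB
    have hi : B.indicator (1 : ℝ → ENNReal) a = ENNReal.ofReal (B.indicator (fun _ => 1) a) := by
      by_cases ha : a ∈ B <;> simp [ha]
    have hi0 : 0 ≤ B.indicator (fun _ => (1 : ℝ)) a := Set.indicator_nonneg (by simp) _
    simp only [measureReal_def]
    rw [h B hB, hi, ← ENNReal.ofReal_mul hc,
      ENNReal.toReal_add ENNReal.ofReal_ne_top (hfin B hB), ENNReal.toReal_ofReal (by positivity),
      integral_eq_lintegral_of_nonneg_ae (Filter.Eventually.of_forall h0)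
        hf.aestronglyMeasurable]

theorem HasGeneralizedDensity.linear_comb {μ ν : Set ℝ → ℝ} {c d a : ℝ} {f g : ℝ → ℝ}
    (hμ : HasGeneralizedDensity μ c a f) (hν : HasGeneralizedDensity ν d a g) (r s : ℝ) :
    HasGeneralizedDensity (fun B => r * μ B + s * ν B) (r * c + s * d) a
      (fun x => r * f x + s * g x) := by
  refine ⟨(hμ.1.const_mul r).add (hν.1.const_mul s), fun B hB => ?_⟩
  dsimp only
  rw [hμ.2 B hB, hν.2 B hB, integral_add (hμ.1.integrableOn.const_mul r)
    (hν.1.integrableOn.const_mul s), integral_const_mul, integral_const_mul]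
  ring

theorem HasGeneralizedDensity.congr {μ ν : Set ℝ → ℝ} {c d a : ℝ} {f g : ℝ → ℝ}
    (hμ : HasGeneralizedDensity μ c a f) (h : ∀ B, MeasurableSet B → ν B = μ B) (hc : d = c)
    (hf : g = f) : HasGeneralizedDensity ν d a g := by
  subst hc hf
  exact ⟨hμ.1, fun B hB => (h B hB).trans (hμ.2 B hB)⟩

/-! ### The contribution of the motions without a change of velocity -/

/-- The density of the position after at least one reset, on the event that the velocity has not
changed since the last reset. -/
noncomputable def straightDensity (v : Fin 2 → ℝ) (lam xi : ℝ) (j : Fin 2) (t x : ℝ) : ℝ :=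
  Real.sign (v j) * ind (0 < x / v j ∧ x / v j < t)
      * (xi * Real.exp (-xi * (x / v j)) / (v j + lam * x))

/-- The sign in the closed form turns `1 / (a + λx)` into the Jacobian `|a|⁻¹` of `x = a s` times
the no-turn probability at age `s = x / a`. -/
theorem straightDensity_eq {a : ℝ} (ha : a ≠ 0) (lam xi x : ℝ) :
    Real.sign a * (xi * Real.exp (-xi * (x / a)) / (a + lam * x))
      = |a|⁻¹ * (xi * Real.exp (-xi * (x / a)) * (1 / (1 + lam * (x / a)))) := by
  have h1 : a + lam * x = a * (1 + lam * (x / a)) := by field_simp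
  rw [h1]
  rcases lt_or_gt_of_ne ha with h | h
  · rw [Real.sign_of_neg h, abs_of_neg h, inv_neg]
    simp only [div_eq_mul_inv, mul_inv]; ring
  · rw [Real.sign_of_pos h, abs_of_pos h]
    simp only [div_eq_mul_inv, mul_inv]; ring

theorem straightDensity_nonneg {v : Fin 2 → ℝ} {lam xi : ℝ} (hlam : 0 < lam) (hxi : 0 < xi)
    {j : Fin 2} (hj : v j ≠ 0) (t x : ℝ) : 0 ≤ straightDensity v lam xi j t x := by
  rw [straightDensity, mul_right_comm, straightDensity_eq hj]
  by_cases h : 0 < x / v j ∧ x / v j < t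
  · have := h.1
    rw [ind_of h]
    positivity
  · rw [ind_of_not h, mul_zero]

theorem measurable_straightDensity (v : Fin 2 → ℝ) (lam xi : ℝ) (j : Fin 2) (t : ℝ) :
    Measurable (straightDensity v lam xi j t) := by
  have h1 := measurable_ind (p := fun x : ℝ => 0 < x / v j ∧ x / v j < t)
    (MeasurableSet.inter
      (measurableSet_lt (g := fun x : ℝ => x / v j) measurable_const (by fun_prop))
      (measurableSet_lt (f := fun x : ℝ => x / v j) (by fun_prop) measurable_const))
  unfold straightDensity
  fun_prop

theorem lintegral_straightDensity {v : Fin 2 → ℝ} {lam xi : ℝ} (hxi : 0 < xi)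
    {j : Fin 2} (hj : v j ≠ 0) (t : ℝ) {B : Set ℝ} (hB : MeasurableSet B) :
    ∫⁻ a in Set.Ioo 0 t, ENNReal.ofReal (xi * Real.exp (-xi * a)) *
        (ENNReal.ofReal (1 / (1 + lam * a)) * B.indicator 1 (v j * a))
      = ∫⁻ x in B, ENNReal.ofReal (straightDensity v lam xi j t x) := by
  have hT : MeasurableSet {x : ℝ | 0 < x / v j ∧ x / v j < t} := MeasurableSet.inter
      (measurableSet_lt (g := fun x : ℝ => x / v j) measurable_const (by fun_prop))
      (measurableSet_lt (f := fun x : ℝ => x / v j) (by fun_prop) measurable_const)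
  have h := setLIntegral_affine (q := 0) hj (S := Set.Ioo 0 t)
    (T := {x : ℝ | 0 < x / v j ∧ x / v j < t}) measurableSet_Ioo hT
    (fun x => by simp) hB fun a => ENNReal.ofReal (xi * Real.exp (-xi * a)) *
      ENNReal.ofReal (1 / (1 + lam * a))
  simp only [add_zero, sub_zero] at h
  simp_rw [← mul_assoc]
  rw [h]
  refine lintegral_congr fun x => ?_
  rw [straightDensity, mul_right_comm, straightDensity_eq hj]
  by_cases hx : 0 < x / v j ∧ x / v j < t
  · rw [Set.indicator_of_mem (show x ∈ {x : ℝ | 0 < x / v j ∧ x / v j < t} from hx), ind_of hx,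
      mul_one, ← ENNReal.ofReal_mul (by positivity), ← ENNReal.ofReal_mul (by positivity)]
  · rw [Set.indicator_of_notMem (show x ∉ {x : ℝ | 0 < x / v j ∧ x / v j < t} from hx),
      ind_of_not hx]
    simp

/-! ### Generalized densities for each final velocity. -/

section Sub

variable {Ω : Type*} [MeasurableSpace Ω] {P : Measure Ω} [IsProbabilityMeasure P]
  {v : Fin 2 → ℝ} {lam xi : ℝ} {R : ℕ → Ω → ℝ} {D : ℕ → Fin 2 → ℕ → Ω → ℝ}

theorem velocity_lt (hv : (v 1 < 0 ∧ 0 < v 0) ∨ (0 < v 1 ∧ v 1 < v 0)) : v 1 < v 0 :=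
  hv.elim (fun h => h.1.trans h.2) And.right

theorem velocity_ne_zero (hv : (v 1 < 0 ∧ 0 < v 0) ∨ (0 < v 1 ∧ v 1 < v 0)) (j : Fin 2) :
    v j ≠ 0 := by
  fin_cases j
  · exact (hv.elim And.right fun h => h.1.trans h.2).ne'
  · exact hv.elim (fun h => h.1.ne) fun h => h.1.ne'

theorem hasGeneralizedDensity_same (hv : (v 1 < 0 ∧ 0 < v 0) ∨ (0 < v 1 ∧ v 1 < v 0))
    (hlam : 0 < lam) (hxi : 0 < xi) (hRD : IsResetTelegraphInput P lam xi R D) (j : Fin 2) {t : ℝ}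
    (ht : 0 < t) :
    HasGeneralizedDensity (positionSubLaw P v R D j j t) (Real.exp (-xi * t) / (1 + lam * t))
      (v j * t) fun x => straightDensity v lam xi j t x
        + mixedDensity v xi (sameDensity v lam j) t x := by
  have hlt := velocity_lt hv
  have hj := velocity_ne_zero hv j
  have hh := isDensityFamily_same hlt hlam j
  have ms := measurable_straightDensity v lam xi j t
  have mm := measurable_mixedDensity hv hxi hh ht
  have ns := straightDensity_nonneg hlam hxi hj t
  have nm := mixedDensity_nonneg hv hxi hh ht
  refine hasGeneralizedDensity_of_measure (by positivity) (ms.add mm)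
    (fun x => add_nonneg (ns x) (nm x)) fun B hB => ?_
  have hm : Measurable fun a : ℝ => B.indicator (1 : ℝ → ENNReal) (v j * a) :=
    (measurable_one.indicator hB).comp (by fun_prop)
  rw [measure_position_sameVelocity hlam hxi hRD hlt.ne' j ht.le hB]
  simp_rw [evenMass_eq hlt lam j _ hB, mul_add, ENNReal.ofReal_add (ns _) (nm _)]
  rw [lintegral_add_left (by fun_prop), lintegral_add_left (by fun_prop),
    lintegral_straightDensity hxi hj t hB, ← lintegral_mixedDensity hv hxi hh ht B,
    ← mul_assoc, ← ENNReal.ofReal_mul (Real.exp_nonneg _), mul_one_div]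
  abel

theorem hasGeneralizedDensity_other (hv : (v 1 < 0 ∧ 0 < v 0) ∨ (0 < v 1 ∧ v 1 < v 0))
    (hlam : 0 < lam) (hxi : 0 < xi) (hRD : IsResetTelegraphInput P lam xi R D) (j : Fin 2) {t : ℝ}
    (ht : 0 < t) :
    HasGeneralizedDensity (positionSubLaw P v R D j (1 - j) t) 0 (v j * t)
      (mixedDensity v xi (otherDensity v lam j) t) := by
  have hlt := velocity_lt hv
  have hh := isDensityFamily_other hlt hlam j
  refine hasGeneralizedDensity_of_measure le_rfl (measurable_mixedDensity hv hxi hh ht)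
    (mixedDensity_nonneg hv hxi hh ht) fun B hB => ?_
  rw [measure_position_otherVelocity hlam hxi hRD hlt.ne' j ht.le hB]
  simp_rw [oddMass_eq hlt lam j _ hB]
  rw [lintegral_mixedDensity hv hxi hh ht B]
  simp

end Sub

/-! ### Closed forms -/

/-- Substitute `u = (a + 1/λ) ξ`; the shift by `ξ/λ` produces the factor `e^(ξ/λ)`. -/
theorem integral_exp_div {lam xi lo hi : ℝ} (hlam : 0 < lam) (hxi : 0 < xi) (hlo : 0 ≤ lo)
    (hle : lo ≤ hi) :
    ∫ a in lo..hi, xi * Real.exp (-xi * a) * (lam / (1 + lam * a))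
      = xi * Real.exp (xi / lam) * genIncGamma 0 ((lo + 1 / lam) * xi) ((hi + 1 / lam) * xi) := by
  have h := intervalIntegral.integral_comp_mul_add (a := lo) (b := hi)
    (fun u : ℝ => u ^ ((0 : ℝ) - 1) * Real.exp (-u)) hxi.ne' (xi / lam)
  have e : ∀ x, (x + 1 / lam) * xi = xi * x + xi / lam := fun x => by ring
  rw [genIncGamma, e, e, ← inv_mul_eq_iff_eq_mul₀ (by positivity), ← intervalIntegral.integral_const_mul]
  rw [smul_eq_mul, eq_inv_mul_iff_mul_eq₀ hxi.ne', ← intervalIntegral.integral_const_mul] at h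
  rw [← h]
  refine intervalIntegral.integral_congr fun a ha => ?_
  rw [Set.uIcc_of_le hle] at ha
  have ha0 : 0 ≤ a := hlo.trans ha.1
  have h1 : 0 < 1 + lam * a := by positivity
  have h2 : xi * a + xi / lam = xi * (1 + lam * a) / lam := by field_simp; ring
  have h3 : Real.exp (-(xi * a + xi / lam)) * Real.exp (xi / lam) = Real.exp (-xi * a) := by
    rw [← Real.exp_add]; congr 1; ring
  rw [← h3, zero_sub, Real.rpow_neg_one, h2]
  field_simp

/-- Integration by parts: the derivative of `-ξ e^(-ξa) / (1 + λa)` is the left integrand plus `ξ/λ`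
times the right one. -/
theorem integral_exp_div_sq {lam xi lo hi : ℝ} (hlam : 0 < lam) (hlo : 0 ≤ lo)
    (hle : lo ≤ hi) :
    ∫ a in lo..hi, xi * Real.exp (-xi * a) * (lam / (1 + lam * a) ^ 2)
      = xi * (Real.exp (-xi * lo) / (1 + lam * lo) - Real.exp (-xi * hi) / (1 + lam * hi))
        - xi / lam * ∫ a in lo..hi, xi * Real.exp (-xi * a) * (lam / (1 + lam * a)) := by
  have hpos : ∀ a ∈ Set.uIcc lo hi, 1 + lam * a ≠ 0 := fun a ha => by
    rw [Set.uIcc_of_le hle] at ha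
    have : 0 ≤ a := hlo.trans ha.1
    positivity
  have i1 : IntervalIntegrable (fun a => xi * Real.exp (-xi * a) * (lam / (1 + lam * a) ^ 2))
      volume lo hi := ContinuousOn.intervalIntegrable (ContinuousOn.mul (by fun_prop)
        (ContinuousOn.div (by fun_prop) (by fun_prop) fun a ha => pow_ne_zero _ (hpos a ha)))
  have i2 : IntervalIntegrable (fun a => xi * Real.exp (-xi * a) * (lam / (1 + lam * a)))
      volume lo hi := ContinuousOn.intervalIntegrable (ContinuousOn.mul (by fun_prop)
        (ContinuousOn.div (by fun_prop) (by fun_prop) hpos))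
  rw [eq_sub_iff_add_eq, ← intervalIntegral.integral_const_mul,
    ← intervalIntegral.integral_add i1 (i2.const_mul _),
    intervalIntegral.integral_eq_sub_of_hasDerivAt
      (f := fun a => -xi * (Real.exp (-xi * a) / (1 + lam * a)))]
  · ring
  · intro a ha
    have h0 := hpos a ha
    have h1 : HasDerivAt (fun a => Real.exp (-xi * a)) (Real.exp (-xi * a) * -xi) a := by
      simpa using ((hasDerivAt_id a).const_mul (-xi)).exp
    have h2 : HasDerivAt (fun a => 1 + lam * a) lam a := by
      simpa using ((hasDerivAt_id a).const_mul lam).const_add 1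
    convert! (h1.div h2 h0).const_mul (-xi) using 1
    field_simp
    ring
  · exact i1.add (i2.const_mul _)

theorem GammaFun_eq (v : Fin 2 → ℝ) (lam xi x t : ℝ) :
    GammaFun v lam xi x t = genIncGamma 0 ((lowerAge v x + 1 / lam) * xi)
      ((upperAge v x t + 1 / lam) * xi) := by
  unfold GammaFun lowerAge upperAge; split_ifs <;> rfl

theorem ThetaFun_eq (v : Fin 2 → ℝ) (lam xi x t : ℝ) :
    ThetaFun v lam xi x t = Real.exp (-xi * lowerAge v x) / (1 + lam * lowerAge v x)
      - Real.exp (-xi * upperAge v x t) / (1 + lam * upperAge v x t) := by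
  unfold ThetaFun lowerAge upperAge; split_ifs <;> rfl

/-- The time spent with each velocity cancels: off the atom, the free position is uniform over the
reachable interval. -/
theorem same_add_other (v : Fin 2 → ℝ) {lam t : ℝ} (hlam : 0 < lam) (ht : 0 ≤ t)
    (j : Fin 2) (x : ℝ) :
    sameDensity v lam j x t + otherDensity v lam j x t = lam / (1 + lam * t) / (v 0 - v 1) := by
  have h1 : 0 < 1 + lam * t := by positivity
  unfold sameDensity otherDensity
  rw [← add_div]
  congr 1
  field_simp
  ring

theorem same_sub_other {v : Fin 2 → ℝ} (hv : v 1 < v 0) {lam t : ℝ} (hlam : 0 < lam) (ht : 0 ≤ t)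
    (j : Fin 2) (x : ℝ) :
    (-1) ^ (j : ℕ) * (sameDensity v lam j x t - otherDensity v lam j x t)
      = lam * (lam * (2 * tau v x t - t) - (-1) ^ (j : ℕ)) / ((v 0 - v 1) * (1 + lam * t) ^ 2) := by
  have h1 : 0 < 1 + lam * t := by positivity
  have hd : 0 < v 0 - v 1 := sub_pos.2 hv
  have h2 := timeIn_add hv 0 x t
  have h3 : timeIn v 0 x t = tau v x t := rfl
  have h4 : timeIn v 1 x t = t - tau v x t := by rw [← h3]; simp at h2; linarith
  unfold sameDensity otherDensity
  fin_cases j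
  · simp [h3]; field_simp; ring
  · simp [h4]; field_simp; ring

/-- A partial fraction decomposition in `t`: since `2 v_{1-j} - (v₁ + v₂) = -(-1)^j (v₁ - v₂)`, the
numerator is `2(v_{1-j} + λx) - (v₁ + v₂)(1 + λt)` up to a factor. The coefficients are then
constant under integration over the age. -/
theorem same_sub_other' {v : Fin 2 → ℝ} (hv : v 1 < v 0) {lam t : ℝ} (hlam : 0 < lam) (ht : 0 ≤ t)
    (j : Fin 2) (x : ℝ) :
    (-1) ^ (j : ℕ) * (sameDensity v lam j x t - otherDensity v lam j x t)
      = 2 * (v (1 - j) + lam * x) / (v 0 - v 1) ^ 2 * (lam / (1 + lam * t) ^ 2)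
        - (v 0 + v 1) / (v 0 - v 1) ^ 2 * (lam / (1 + lam * t)) := by
  have h1 : 0 < 1 + lam * t := by positivity
  have hd : 0 < v 0 - v 1 := sub_pos.2 hv
  rw [same_sub_other hv hlam ht, tau]
  fin_cases j
  · simp; field_simp; ring
  · simp; field_simp; ring

section Closed

variable {v : Fin 2 → ℝ} {lam xi t : ℝ}

theorem mixedDensity_linear_comb (hv : (v 1 < 0 ∧ 0 < v 0) ∨ (0 < v 1 ∧ v 1 < v 0)) (ht : 0 < t)
    {h g : ℝ → ℝ → ℝ} (hh : IsDensityFamily v h) (hg : IsDensityFamily v g) (r s x : ℝ) :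
    r * mixedDensity v xi h t x + s * mixedDensity v xi g t x
      = mixedDensity v xi (fun x a => r * h x a + s * g x a) t x := by
  unfold mixedDensity
  by_cases hx : min (v 1 * t) 0 < x ∧ x < v 0 * t
  · obtain ⟨hl, hlu⟩ := lowerAge_bounds hv ht hx
    have hi : ∀ {h : ℝ → ℝ → ℝ}, IsDensityFamily v h → IntervalIntegrable
        (fun a => xi * Real.exp (-xi * a) * h x a) volume (lowerAge v x) (upperAge v x t) := by
      intro h hh
      refine ContinuousOn.intervalIntegrable (ContinuousOn.mul (by fun_prop)
        ((hh.continuousOn x).mono fun a ha => ?_))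
      rw [Set.uIcc_of_le hlu] at ha
      exact hl.trans ha.1
    have : ∀ a, xi * Real.exp (-xi * a) * (r * h x a + s * g x a)
        = r * (xi * Real.exp (-xi * a) * h x a) + s * (xi * Real.exp (-xi * a) * g x a) :=
      fun a => by ring
    simp_rw [this]
    rw [intervalIntegral.integral_add ((hi hh).const_mul r) ((hi hg).const_mul s),
      intervalIntegral.integral_const_mul, intervalIntegral.integral_const_mul]
    ring
  · rw [boldI, ind_of_not hx]
    ring

/-- Agreement for nonnegative ages suffices, as `lowerAge` is nonnegative wherever `boldI` is
nonzero; the closed forms need `1 + λa ≠ 0`. -/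
theorem mixedDensity_congr (hv : (v 1 < 0 ∧ 0 < v 0) ∨ (0 < v 1 ∧ v 1 < v 0)) (ht : 0 < t)
    {h g : ℝ → ℝ → ℝ} {x : ℝ} (hhg : ∀ a, 0 ≤ a → h x a = g x a) :
    mixedDensity v xi h t x = mixedDensity v xi g t x := by
  unfold mixedDensity
  rw [hhg t ht.le]
  by_cases hx : min (v 1 * t) 0 < x ∧ x < v 0 * t
  · obtain ⟨hl, hlu⟩ := lowerAge_bounds hv ht hx
    congr 2
    refine intervalIntegral.integral_congr fun a ha => ?_
    rw [Set.uIcc_of_le hlu] at ha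
    rw [hhg a (hl.trans ha.1)]
  · rw [boldI, ind_of_not hx, zero_mul, zero_mul]

theorem boldI_mul_congr {x a b : ℝ}
    (h : min (v 1 * t) 0 < x ∧ x < v 0 * t → a = b) : boldI v x t * a = boldI v x t * b := by
  by_cases hx : min (v 1 * t) 0 < x ∧ x < v 0 * t
  · rw [h hx]
  · rw [boldI, ind_of_not hx, zero_mul, zero_mul]

theorem densityRegular_eq (hv : (v 1 < 0 ∧ 0 < v 0) ∨ (0 < v 1 ∧ v 1 < v 0)) (hlam : 0 < lam)
    (hxi : 0 < xi) (ht : 0 < t) (j : Fin 2) (x : ℝ) :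
    densityRegular v lam xi j t x = straightDensity v lam xi j t x
      + mixedDensity v xi (sameDensity v lam j) t x
      + mixedDensity v xi (otherDensity v lam j) t x := by
  have hlt := velocity_lt hv
  have hd : 0 < v 0 - v 1 := sub_pos.2 hlt
  have h1 : 0 < 1 + lam * t := by positivity
  have h := mixedDensity_linear_comb (xi := xi) hv ht (isDensityFamily_same hlt hlam j)
    (isDensityFamily_other hlt hlam j) 1 1 x
  rw [one_mul, one_mul] at h
  rw [add_assoc, h, mixedDensity_congr hv ht
    (g := fun _ a => lam / (1 + lam * a) / (v 0 - v 1)) fun a ha => by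
      rw [one_mul, one_mul, same_add_other v hlam ha]]
  unfold densityRegular mixedDensity straightDensity
  rw [add_assoc, mul_assoc (boldI v x t)]
  congr 2
  · field_simp
  · refine boldI_mul_congr fun hx => ?_
    obtain ⟨hl, hlu⟩ := lowerAge_bounds hv ht hx
    simp_rw [← mul_div_assoc]
    rw [intervalIntegral.integral_div]
    simp_rw [mul_div_assoc]
    rw [integral_exp_div hlam hxi hl hlu, GammaFun_eq]
    ring

theorem flowRegular_eq (hv : (v 1 < 0 ∧ 0 < v 0) ∨ (0 < v 1 ∧ v 1 < v 0)) (hlam : 0 < lam)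
    (hxi : 0 < xi) (ht : 0 < t) (j : Fin 2) (x : ℝ) :
    flowRegular v lam xi j t x = (-1) ^ (j : ℕ) * (straightDensity v lam xi j t x
      + mixedDensity v xi (sameDensity v lam j) t x)
      + -(-1) ^ (j : ℕ) * mixedDensity v xi (otherDensity v lam j) t x := by
  have hlt := velocity_lt hv
  have hd : 0 < v 0 - v 1 := sub_pos.2 hlt
  have h1 : 0 < 1 + lam * t := by positivity
  have h := mixedDensity_linear_comb (xi := xi) hv ht (isDensityFamily_same hlt hlam j)
    (isDensityFamily_other hlt hlam j) ((-1) ^ (j : ℕ)) (-(-1) ^ (j : ℕ)) x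
  rw [mul_add, add_assoc, h]
  have hc : ∀ a, (-1) ^ (j : ℕ) * sameDensity v lam j x a
      + -(-1) ^ (j : ℕ) * otherDensity v lam j x a
      = (-1) ^ (j : ℕ) * (sameDensity v lam j x a - otherDensity v lam j x a) := fun a => by ring
  unfold flowRegular mixedDensity straightDensity
  simp_rw [hc]
  rw [same_sub_other hlt hlam ht.le, add_comm (ind _ * _), add_assoc]
  congr 1
  · ring
  congr 1
  · ring
  refine boldI_mul_congr fun hx => ?_
  obtain ⟨hl, hlu⟩ := lowerAge_bounds hv ht hx
  have hpos : ∀ a ∈ Set.uIcc (lowerAge v x) (upperAge v x t), 1 + lam * a ≠ 0 := fun a ha => by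
    rw [Set.uIcc_of_le hlu] at ha
    have : 0 ≤ a := hl.trans ha.1
    positivity
  have i1 : IntervalIntegrable (fun a => xi * Real.exp (-xi * a) * (lam / (1 + lam * a) ^ 2))
      volume (lowerAge v x) (upperAge v x t) :=
    ContinuousOn.intervalIntegrable (ContinuousOn.mul (by fun_prop)
      (ContinuousOn.div (by fun_prop) (by fun_prop) fun a ha => pow_ne_zero _ (hpos a ha)))
  have i2 : IntervalIntegrable (fun a => xi * Real.exp (-xi * a) * (lam / (1 + lam * a)))
      volume (lowerAge v x) (upperAge v x t) :=
    ContinuousOn.intervalIntegrable (ContinuousOn.mul (by fun_prop)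
      (ContinuousOn.div (by fun_prop) (by fun_prop) hpos))
  have he : ∫ a in (lowerAge v x)..(upperAge v x t), xi * Real.exp (-xi * a) *
        ((-1) ^ (j : ℕ) * (sameDensity v lam j x a - otherDensity v lam j x a))
      = ∫ a in (lowerAge v x)..(upperAge v x t), (2 * (v (1 - j) + lam * x) / (v 0 - v 1) ^ 2 *
          (xi * Real.exp (-xi * a) * (lam / (1 + lam * a) ^ 2))
        - (v 0 + v 1) / (v 0 - v 1) ^ 2 * (xi * Real.exp (-xi * a) * (lam / (1 + lam * a)))) := by
    refine intervalIntegral.integral_congr fun a ha => ?_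
    rw [Set.uIcc_of_le hlu] at ha
    rw [same_sub_other' hlt hlam (hl.trans ha.1)]
    ring
  -- Clears the quotient `x / v (1 - j)` in the stated form of the flow.
  have hne := velocity_ne_zero hv (1 - j)
  rw [he, intervalIntegral.integral_sub (i1.const_mul _) (i2.const_mul _),
    intervalIntegral.integral_const_mul, intervalIntegral.integral_const_mul,
    integral_exp_div_sq hlam hl hlu, integral_exp_div hlam hxi hl hlu, ← GammaFun_eq,
    ← ThetaFun_eq]
  field_simp
  ring

end Closed

theorem mainTheorem2 {Ω : Type*} [MeasurableSpace Ω] (P : Measure Ω) [IsProbabilityMeasure P]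
    (v : Fin 2 → ℝ) (hv : (v 1 < 0 ∧ 0 < v 0) ∨ (0 < v 1 ∧ v 1 < v 0))
    (lam xi : ℝ) (hlam : 0 < lam) (hxi : 0 < xi)
    (R : ℕ → Ω → ℝ) (D : ℕ → Fin 2 → ℕ → Ω → ℝ) (hRD : IsResetTelegraphInput P lam xi R D)
    (j : Fin 2) (t : ℝ) (ht : 0 < t) :
    HasGeneralizedDensity (positionLaw P v R D j t)
        (Real.exp (-xi * t) / (1 + lam * t)) (v j * t) (densityRegular v lam xi j t) ∧
      HasGeneralizedDensity (flowMeasure P v R D j t)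
        ((-1) ^ (j : ℕ) * (Real.exp (-xi * t) / (1 + lam * t))) (v j * t)
        (flowRegular v lam xi j t) := by
  have hs := hasGeneralizedDensity_same hv hlam hxi hRD j ht
  have ho := hasGeneralizedDensity_other hv hlam hxi hRD j ht
  constructor
  · refine (hs.linear_comb ho 1 1).congr (fun B hB => ?_) (by ring) ?_
    · rw [one_mul, one_mul]
      exact positionLaw_eq_add hlam hxi hRD (velocity_lt hv).ne' j ht.le hB
    · ext x
      rw [densityRegular_eq hv hlam hxi ht]; ring
  -- Relative to the initial velocity, the flow is `(-1)^j` times the same-velocity part minus the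
  -- other-velocity part; only the former carries an atom.
  · refine (hs.linear_comb ho ((-1) ^ (j : ℕ)) (-(-1) ^ (j : ℕ))).congr (fun B _ => ?_) (by ring) ?_
    · fin_cases j
      · simp [flowMeasure, sub_eq_add_neg]
      · simp [flowMeasure, sub_eq_add_neg, add_comm]
    · ext x
      rw [flowRegular_eq hv hlam hxi ht]
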